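/- Let $n\ge 1$, let $S^n\subset\mathbb R^{n+1}$ be the unit sphere with its round metric $g_{S^n}$, and let $$g_+=r^{-2}\bigl(dr^2+(1-r^2/4)^2g_{S^n}\bigr)\qquad\text{on } S^n\times(0,2)$$ be the associated Poincaré–Einstein (hyperbolic) metric. Let $\Delta_{g_+}$ be its non-positive Laplacian and let $C^\infty(S^n)$ denote the smooth complex-valued functions. For $\lambda\in\mathbb C$ and $m\ge 0$, call $a_0,\dots,a_m\in C^\infty(S^n)$ the coefficients of a formal solution up to order $m$ if $u=\sum_{k=0}^m r^{\lambda+k}a_k$ satisfies $$\Delta_{g_+}u+\lambda(n-\lambda)u=O\bigl(r^{\operatorname{Re}\lambda+m+1}\bigr)\qquad (r\to0+)$$ at every point of $S^n$. Let $N\ge 0$, and write $(x)_N=x(x+1)\cdots(x+N-1)$. (a) For $\lambda\notin\{\frac n2-1,\dots,\frac n2-N\}$ there is a unique linear operator $\mathcal T_{2N}(\lambda)$ on $C^\infty(S^n)$ such that every $f\in C^\infty(S^n)$ is the coefficient $a_0$ of a formal solution up to order $2N$, and $a_{2N}=\mathcal T_{2N}(\lambda)f$ for every such solution with $a_0=f$.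 There is a unique family $P_{2N}(\lambda)$, $\lambda\in\mathbb C$, of linear operators on $C^\infty(S^n)$ which is polynomial in $\lambda$ and satisfies $$\mathcal T_{2N}(\lambda)=\frac{1}{2^{2N}N!\,(\frac n2-\lambda-1)\cdots(\frac n2-\lambda-N)}\,P_{2N}(\lambda)$$ for all such $\lambda$. For every $\lambda\in\mathbb C$ the operator $P_{2N}(\lambda)$ has a unique formal adjoint $P_{2N}^*(\lambda)$ on $C^\infty(S^n)$ with respect to the bilinear pairing $\int_{S^n}fg\,\mathrm{vol}$. (b) For all $\lambda\in\mathbb C$, $$P_{2N}(\lambda)(1)=P_{2N}^*(\lambda)(1)=(-1)^N\left(\tfrac n2\right)_N(\lambda)_N .$$ (c) Equivalently, for all $\lambda\notin\{\frac n2-1,\dots,\frac n2-N\}$, $$\mathcal T_{2N}(\lambda)(1)=\frac{(\frac n2)_N\,(\lambda)_N}{2^{2N}N!\,(\lambda-\frac n2+1)_N}.$$ -/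

import Mathlib

open scoped Manifold ContDiff
open MeasureTheory Asymptotics Filter Topology

noncomputable section

section LaplaceBeltrami

variable {ι E H : Type*} [Fintype ι] [DecidableEq ι] [NormedAddCommGroup E] [NormedSpace ℝ E]
  [TopologicalSpace H] (I : ModelWithCorners ℝ E H)
  (M : Type*) [TopologicalSpace M] [ChartedSpace H M]

/-- A field of bilinear forms on the tangent spaces of `M`
(a Riemannian metric wherever the forms are symmetric and positive definite). -/
abbrev MetricField : Type _ := ∀ p : M, LinearMap.BilinForm ℝ (TangentSpace I p)

variable {I M}

/-- The components `g i j` of `g` at the coordinates `y` of the preferred chart at `x`: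
the form `g` applied to the `i`-th and `j`-th coordinate vector fields
(the linear coordinates on the model space `E` being those of the basis `b`). -/
def metricComponents (b : Module.Basis ι ℝ E) (g : MetricField I M) (x : M) (y : E) :
    Matrix ι ι ℝ :=
  Matrix.of fun i j =>
    g ((extChartAt I x).symm y)
      (mfderiv 𝓘(ℝ, E) I (extChartAt I x).symm y (b i))
      (mfderiv 𝓘(ℝ, E) I (extChartAt I x).symm y (b j))

/-- The (non-positive) Laplace-Beltrami operator
`|g|^(-1/2) ∑ i, ∂ᵢ (∑ j, |g|^(1/2) gⁱʲ ∂ⱼ u)` of `g` on complex-valued functions, computed at `x`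
in the preferred chart at `x` (for manifolds without boundary). -/
def laplaceBeltrami (b : Module.Basis ι ℝ E) (g : MetricField I M) (u : M → ℂ) (x : M) : ℂ :=
  (Real.sqrt (metricComponents b g x (extChartAt I x x)).det)⁻¹ •
    ∑ i, fderiv ℝ
      (fun y : E => ∑ j,
        (Real.sqrt (metricComponents b g x y).det * (metricComponents b g x y)⁻¹ i j) •
          fderiv ℝ (u ∘ (extChartAt I x).symm) y (b j))
      (extChartAt I x x) (b i)

/-- The metric `g₊ = r⁻² (dr² + h_r)` on `M × ℝ`, at the point `(p, r)`; it is meant at points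
with `r > 0`. -/
def normalFormMetric (h : ℝ → MetricField I M) : MetricField (I.prod 𝓘(ℝ, ℝ)) (M × ℝ) :=
  fun p =>
    let hp : LinearMap.BilinForm ℝ E := h p.2 p.1
    let gp : LinearMap.BilinForm ℝ (E × ℝ) :=
      (p.2 ^ 2)⁻¹ •
        ((LinearMap.mul ℝ ℝ).compl₁₂ (LinearMap.snd ℝ E ℝ) (LinearMap.snd ℝ E ℝ) +
          hp.compl₁₂ (LinearMap.fst ℝ E ℝ) (LinearMap.fst ℝ E ℝ))
    gp

end LaplaceBeltrami

/-- The unit sphere `Sⁿ` in `ℝⁿ⁺¹`. -/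
abbrev Sph (n : ℕ) : Type := Metric.sphere (0 : EuclideanSpace ℝ (Fin (n + 1))) 1

/-- The round metric on `Sⁿ`: the pullback of the Euclidean inner product. -/
def roundMetric (n : ℕ) : MetricField (𝓡 n) (Sph n) := fun p =>
  LinearMap.compl₁₂ (innerₗ (EuclideanSpace ℝ (Fin (n + 1))))
    (mfderiv (𝓡 n) 𝓘(ℝ, EuclideanSpace ℝ (Fin (n + 1)))
      ((↑) : Sph n → EuclideanSpace ℝ (Fin (n + 1))) p).toLinearMap
    (mfderiv (𝓡 n) 𝓘(ℝ, EuclideanSpace ℝ (Fin (n + 1)))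
      ((↑) : Sph n → EuclideanSpace ℝ (Fin (n + 1))) p).toLinearMap

/-- The Poincaré-Einstein metric of the round sphere,
`g₊ = r⁻² (dr² + (1 - r²/4)² g_{Sⁿ})` on `Sⁿ × (0, 2)`. -/
def spherePEMetric (n : ℕ) : MetricField ((𝓡 n).prod 𝓘(ℝ, ℝ)) (Sph n × ℝ) :=
  normalFormMetric fun r p => ((1 - r ^ 2 / 4) ^ 2 : ℝ) • roundMetric n p

/-- The Laplacian of `g₊`, used at points `(x, r)` with `0 < r < 2`. -/
def lapPE (n : ℕ) (u : Sph n × ℝ → ℂ) (q : Sph n × ℝ) : ℂ :=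
  laplaceBeltrami
    ((EuclideanSpace.basisFun (Fin n) ℝ).toBasis.prod (Module.Basis.singleton Unit ℝ))
    (spherePEMetric n) u q

/-- `C^∞(Sⁿ)`: smooth complex-valued functions on the sphere. -/
def SmoothFn (n : ℕ) : Submodule ℂ (Sph n → ℂ) where
  carrier := {f | ContMDiff (𝓡 n) 𝓘(ℝ, ℂ) ∞ f}
  add_mem' hf hg := ContMDiff.add hf hg
  zero_mem' := contMDiff_const
  smul_mem' c _ hf := (contDiff_const_smul (𝕜 := ℝ) (F := ℂ) (n := ∞) c).comp_contMDiff hf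

/-- The constant function `1` on `Sⁿ`. -/
def oneFn (n : ℕ) : SmoothFn n := ⟨fun _ => 1, contMDiff_const (I := 𝓡 n) (I' := 𝓘(ℝ, ℂ)) (n := ∞)⟩

/-- Linear operators on `C^∞(Sⁿ)`. -/
abbrev SmoothOp (n : ℕ) : Type := SmoothFn n →ₗ[ℂ] SmoothFn n

/-- The finite expansion `u(x, r) = ∑ k ≤ m, r^(lam + k) a_k(x)`. -/
def expansion (n : ℕ) (lam : ℂ) (m : ℕ) (a : ℕ → SmoothFn n) : Sph n × ℝ → ℂ :=
  fun q => ∑ k ∈ Finset.range (m + 1), (q.2 : ℂ) ^ (lam + k) * (a k : Sph n → ℂ) q.1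

/-- `a_0, …, a_m` are the coefficients of a solution of `-Δ_{g₊} u = lam (n - lam) u` up to order
`m`: the expansion `u` satisfies `Δ_{g₊} u + lam (n - lam) u = O(r^(lam + m + 1))` as `r → 0+`. -/
def IsFormalSolution (n : ℕ) (lam : ℂ) (m : ℕ) (a : ℕ → SmoothFn n) : Prop :=
  ∀ x : Sph n,
    (fun r : ℝ => lapPE n (expansion n lam m a) (x, r)
        + lam * (n - lam) * expansion n lam m a (x, r))
      =O[𝓝[>] 0] fun r : ℝ => r ^ (lam.re + m + 1)

/-- `A` is the operator `T_{2N}(lam)`: every `f` is the leading coefficient `a_0` of a solution up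
to order `2N`, and `A f` is the coefficient `a_{2N}` of every such solution. -/
def IsSolutionOperator (n N : ℕ) (lam : ℂ) (A : SmoothOp n) : Prop :=
  ∀ f : SmoothFn n,
    (∃ a : ℕ → SmoothFn n, a 0 = f ∧ IsFormalSolution n lam (2 * N) a) ∧
    ∀ a : ℕ → SmoothFn n, a 0 = f → IsFormalSolution n lam (2 * N) a → a (2 * N) = A f

/-- The normalizing factor `2^(2N) N! (n/2 - lam - 1) ⋯ (n/2 - lam - N)`. -/
def normFactor (n N : ℕ) (lam : ℂ) : ℂ :=
  2 ^ (2 * N) * (N.factorial : ℂ) * ∏ j ∈ Finset.Icc 1 N, ((n : ℂ) / 2 - lam - j)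

/-- `lam` is none of the possible poles `n/2 - 1, …, n/2 - N` of `T_{2N}`. -/
def IsRegularParameter (n N : ℕ) (lam : ℂ) : Prop :=
  ∀ j ∈ Finset.Icc 1 N, lam ≠ (n : ℂ) / 2 - j

/-- `P` is the family `P_{2N}(·)`: it is polynomial in the parameter, and
`T_{2N}(lam) = P(lam) / (2^(2N) N! (n/2 - lam - 1) ⋯ (n/2 - lam - N))` away from the poles. -/
def IsPFamily (n N : ℕ) (P : ℂ → SmoothOp n) : Prop :=
  (∃ (d : ℕ) (C : ℕ → SmoothOp n), ∀ lam : ℂ, P lam = ∑ k ∈ Finset.range (d + 1), lam ^ k • C k) ∧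
  ∀ lam : ℂ, IsRegularParameter n N lam →
    IsSolutionOperator n N lam ((normFactor n N lam)⁻¹ • P lam)

/-- `B` is the formal adjoint `A*` of `A` with respect to the bilinear pairing `∫ f g` over the
round sphere with its surface measure. -/
def IsFormalAdjoint {n : ℕ} (A B : SmoothOp n) : Prop :=
  ∀ f g : SmoothFn n,
    ∫ x, (A f : Sph n → ℂ) x * (g : Sph n → ℂ) x
        ∂(volume : Measure (EuclideanSpace ℝ (Fin (n + 1)))).toSphere =
      ∫ x, (f : Sph n → ℂ) x * (B g : Sph n → ℂ) x
        ∂(volume : Measure (EuclideanSpace ℝ (Fin (n + 1)))).toSphere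

/-- The Pochhammer symbol `(x)_N = x (x + 1) ⋯ (x + N - 1)`. -/
def poch (x : ℂ) (N : ℕ) : ℂ := ∏ j ∈ Finset.range N, (x + j)

end

open scoped RealInnerProductSpace

noncomputable section

/-! On a product `g(r) A(x)` the Laplacian of `g₊` acts by an ordinary differential operator in `r`
plus `r² (1 - r²/4)⁻² g Δ A`, with `Δ` the Laplacian of the round sphere (`lapPE_sum_separated`).
For `g = r^(lam + k)`, multiplying by `(1 - r²/4)²` leaves `r^lam` times a polynomial in `r`. Hence
being a formal solution is a recursion linking `a_d`, `a_(d-2)`, `a_(d-4)` (`isFormalSolution_iff`).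
Even and odd indices decouple. For even indices, clearing the indicial factors gives `normFactor n j
lam • a_(2j) = poissonOp n lam j a_0`, where `poissonOp` is polynomial in `lam` and `Δ`. This
identifies `T_{2N}` (`isSolutionOperator_iff`) and, as a polynomial is determined off a finite set,
also `P_{2N}` (`isPFamily_iff`).

Since `Δ 1 = 0`, the recursion applied to `1` is scalar, and the Pochhammer product solves it
(`poissonOp_oneFn`). The operator `Δ` is symmetric (`integral_sphLap_mul`), so `P_{2N}`, a
polynomial in `Δ`, is its own formal adjoint and the adjoint takes the same value at `1`. Symmetry
comes from Green's identity in `ℝⁿ⁺¹` for extensions homogeneous of degree `0`, cut off by a radial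
function. -/

/-- The ambient space `ℝⁿ⁺¹` of the sphere `Sⁿ`. -/
abbrev Amb (n : ℕ) : Type := EuclideanSpace ℝ (Fin (n + 1))

/-- The model space `ℝⁿ` of the sphere `Sⁿ`. -/
abbrev Mdl (n : ℕ) : Type := EuclideanSpace ℝ (Fin n)

/-! ### Stereographic charts and the components of `g₊`. -/

/-- The inverse of the preferred chart of the sphere at `x`, as a map into the ambient space. -/
def sphParam {n : ℕ} (x : Sph n) (w : Mdl n) : Amb n := ((chartAt (Mdl n) x).symm w : Sph n)

/-- The preferred chart at `x` is stereographic projection from `-x` followed by an isometry of the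
hyperplane orthogonal to `x` with `ℝⁿ`; `J` inverts that isometry. Only its isometry and
orthogonality to `x` matter later. -/
theorem exists_sphParam_eq {n : ℕ} (x : Sph n) :
    ∃ J : Mdl n →ₗᵢ[ℝ] Amb n, (∀ w, ⟪(x : Amb n), J w⟫ = 0) ∧
      ∀ w, sphParam x w =
        (‖w‖ ^ 2 + 4)⁻¹ • ((4 : ℝ) • J w + (4 - ‖w‖ ^ 2) • (x : Amb n)) := by
  have := Fact.mk (@finrank_euclideanSpace_fin ℝ _ (n + 1))
  let U := (OrthonormalBasis.fromOrthogonalSpanSingleton (𝕜 := ℝ) n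
    (ne_zero_of_mem_unit_sphere (-x))).repr
  refine ⟨(Submodule.subtypeₗᵢ _).comp U.symm.toLinearIsometry, fun w => ?_, fun w => ?_⟩
  · have h := Submodule.mem_orthogonal_singleton_iff_inner_right.mp (U.symm w).2
    have h' : ⟪(x : Amb n), ((U.symm w : _) : Amb n)⟫ = 0 := by simpa using h
    exact h'
  · have h := stereographic'_symm_apply (-x) w
    have hn : ‖((U.symm w : _) : Amb n)‖ = ‖w‖ := by
      rw [Submodule.norm_coe, LinearIsometryEquiv.norm_map]
    change sphParam x w = _ at h
    rw [h]
    simp only [U] at hn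
    simp only [hn, smul_add, U]
    congr 1
    simp only [Metric.sphere, coe_neg_sphere, smul_neg, ← neg_smul, smul_smul]
    congr 1
    ring

theorem contDiff_sphParam {n : ℕ} (x : Sph n) : ContDiff ℝ ω (sphParam x) := by
  obtain ⟨J, -, hJ⟩ := exists_sphParam_eq x
  rw [show sphParam x = _ from funext hJ]
  have h : ContDiff ℝ ω fun w : Mdl n => ‖w‖ ^ 2 + 4 := (contDiff_norm_sq ℝ).add contDiff_const
  refine ContDiff.fun_smul (h.inv fun w => by positivity) ?_
  exact (J.toContinuousLinearMap.contDiff.const_smul (4 : ℝ)).add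
    ((contDiff_const.sub (contDiff_norm_sq ℝ)).smul contDiff_const)

theorem fderiv_sphParam_apply {n : ℕ} {x : Sph n} {J : Mdl n →ₗᵢ[ℝ] Amb n}
    (hJ : ∀ w, sphParam x w =
        (‖w‖ ^ 2 + 4)⁻¹ • ((4 : ℝ) • J w + (4 - ‖w‖ ^ 2) • (x : Amb n))) (w v : Mdl n) :
    fderiv ℝ (sphParam x) w v = (‖w‖ ^ 2 + 4)⁻¹ • (4 : ℝ) • J v
      - (8 * ⟪w, v⟫ * ((‖w‖ ^ 2 + 4)⁻¹) ^ 2) • J w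
      - (16 * ⟪w, v⟫ * ((‖w‖ ^ 2 + 4)⁻¹) ^ 2) • (x : Amb n) := by
  have hne : ‖w‖ ^ 2 + 4 ≠ 0 := by positivity
  have h1 : HasFDerivAt (fun w : Mdl n => ‖w‖ ^ 2) (2 • innerSL ℝ w) w :=
    (hasStrictFDerivAt_norm_sq w).hasFDerivAt
  have h2 := (hasFDerivAt_inv hne).comp w (h1.add_const 4)
  have h3 := (J.toContinuousLinearMap.hasFDerivAt (x := w)).const_smul (4 : ℝ)
  have h4 := (h1.const_sub 4).smul_const (x : Amb n)
  have h5 := h2.smul (h3.add h4)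
  have h6 : HasFDerivAt (sphParam x) _ w :=
    h5.congr_of_eventuallyEq (Eventually.of_forall hJ)
  rw [h6.fderiv]
  simp
  match_scalars
  · ring
  · field_simp
    ring
  · field_simp
    ring

/-- Stereographic projection is conformal: the terms in `⟪w, e⟫ * ⟪w, e'⟫` cancel. -/
theorem inner_fderiv_sphParam {n : ℕ} (x : Sph n) (w e e' : Mdl n) :
    ⟪fderiv ℝ (sphParam x) w e, fderiv ℝ (sphParam x) w e'⟫ =
      (4 / (‖w‖ ^ 2 + 4)) ^ 2 * ⟪e, e'⟫ := by
  obtain ⟨J, hx, hJ⟩ := exists_sphParam_eq x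
  have hxx : ⟪(x : Amb n), (x : Amb n)⟫ = 1 := by simp
  have hx' : ∀ w, ⟪J w, (x : Amb n)⟫ = 0 := fun w => by rw [real_inner_comm, hx]
  simp only [fderiv_sphParam_apply hJ, inner_sub_left, inner_sub_right, inner_smul_left, inner_smul_right,
    hx, hx', hxx,
    J.inner_map_map, real_inner_self_eq_norm_sq, real_inner_comm w e]
  simp only [conj_trivial]
  field_simp
  ring

theorem chartAt_sph_self {n : ℕ} (x : Sph n) : chartAt (Mdl n) x x = 0 := by
  have := Fact.mk (@finrank_euclideanSpace_fin ℝ _ (n + 1))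
  change (OrthonormalBasis.fromOrthogonalSpanSingleton (𝕜 := ℝ) n
    (ne_zero_of_mem_unit_sphere (-x))).repr (stereographic (norm_eq_of_mem_sphere (-x)) x) = 0
  rw [stereographic_neg_apply, map_zero]

theorem extChartAt_sph_prod_self {n : ℕ} (x : Sph n) (r : ℝ) :
    extChartAt ((𝓡 n).prod 𝓘(ℝ, ℝ)) (x, r) (x, r) = (0, r) := by
  exact Prod.ext (chartAt_sph_self x) rfl

theorem extChartAt_sph_prod_target {n : ℕ} (x : Sph n) (r : ℝ) :
    (extChartAt ((𝓡 n).prod 𝓘(ℝ, ℝ)) (x, r)).target = Set.univ := by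
  have := Fact.mk (@finrank_euclideanSpace_fin ℝ _ (n + 1))
  have : (chartAt (Mdl n) x).target = Set.univ := stereographic'_target (-x)
  rw [extChartAt_prod]
  simp only [extChartAt, OpenPartialHomeomorph.extend, PartialEquiv.prod_target,
    PartialEquiv.trans_target]
  simp [this, chartAt_self_eq]

theorem mdifferentiableAt_extChartAt_sph_prod_symm {n : ℕ} (x : Sph n) (r : ℝ) (y : Mdl n × ℝ) :
    MDifferentiableAt 𝓘(ℝ, Mdl n × ℝ) ((𝓡 n).prod 𝓘(ℝ, ℝ))
      (extChartAt ((𝓡 n).prod 𝓘(ℝ, ℝ)) (x, r)).symm y := by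
  have h := contMDiffOn_extChartAt_symm (I := (𝓡 n).prod 𝓘(ℝ, ℝ)) (n := 1) (x, r)
  rw [extChartAt_sph_prod_target, contMDiffOn_univ] at h
  exact h.mdifferentiable one_ne_zero y

theorem spherePEMetric_mfderiv {n : ℕ} (x : Sph n) (r : ℝ) (y v v' : Mdl n × ℝ) :
    spherePEMetric n ((extChartAt ((𝓡 n).prod 𝓘(ℝ, ℝ)) (x, r)).symm y)
      (mfderiv 𝓘(ℝ, Mdl n × ℝ) ((𝓡 n).prod 𝓘(ℝ, ℝ))
        (extChartAt ((𝓡 n).prod 𝓘(ℝ, ℝ)) (x, r)).symm y v)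
      (mfderiv 𝓘(ℝ, Mdl n × ℝ) ((𝓡 n).prod 𝓘(ℝ, ℝ))
        (extChartAt ((𝓡 n).prod 𝓘(ℝ, ℝ)) (x, r)).symm y v') =
    (y.2 ^ 2)⁻¹ * (v.2 * v'.2 + (1 - y.2 ^ 2 / 4) ^ 2 *
      ((4 / (‖y.1‖ ^ 2 + 4)) ^ 2 * ⟪v.1, v'.1⟫)) := by
  have := Fact.mk (@finrank_euclideanSpace_fin ℝ _ (n + 1))
  set ψ := (extChartAt ((𝓡 n).prod 𝓘(ℝ, ℝ)) (x, r)).symm with hψ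
  have hd : MDifferentiableAt 𝓘(ℝ, Mdl n × ℝ) ((𝓡 n).prod 𝓘(ℝ, ℝ)) ψ y :=
    mdifferentiableAt_extChartAt_sph_prod_symm x r y
  have h2 : ∀ v : Mdl n × ℝ,
      (mfderiv 𝓘(ℝ, Mdl n × ℝ) ((𝓡 n).prod 𝓘(ℝ, ℝ)) ψ y v).2 = v.2 := by
    intro v
    have h := mfderiv_comp_apply (I := 𝓘(ℝ, Mdl n × ℝ)) (I' := (𝓡 n).prod 𝓘(ℝ, ℝ))
      (I'' := 𝓘(ℝ, ℝ)) y (g := Prod.snd) (f := ψ) mdifferentiableAt_snd hd v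
    rw [mfderiv_snd, show Prod.snd ∘ ψ = (Prod.snd : Mdl n × ℝ → ℝ) from rfl,
      mfderiv_eq_fderiv, fderiv_snd] at h
    exact h.symm
  have hc : MDifferentiableAt (𝓡 n) 𝓘(ℝ, Amb n) ((↑) : Sph n → Amb n) (ψ y).1 :=
    (contMDiff_coe_sphere (m := 1)).mdifferentiable one_ne_zero _
  have h1 : ∀ v : Mdl n × ℝ,
      mfderiv (𝓡 n) 𝓘(ℝ, Amb n) ((↑) : Sph n → Amb n) (ψ y).1
        (mfderiv 𝓘(ℝ, Mdl n × ℝ) ((𝓡 n).prod 𝓘(ℝ, ℝ)) ψ y v).1 =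
      fderiv ℝ (sphParam x) y.1 v.1 := by
    intro v
    have h := mfderiv_comp_apply (I := 𝓘(ℝ, Mdl n × ℝ)) (I' := (𝓡 n).prod 𝓘(ℝ, ℝ))
      (I'' := 𝓡 n) y (g := Prod.fst) (f := ψ) mdifferentiableAt_fst hd v
    rw [mfderiv_fst] at h
    have h' := mfderiv_comp_apply (I := 𝓘(ℝ, Mdl n × ℝ)) (I' := 𝓡 n)
      (I'' := 𝓘(ℝ, Amb n)) y (g := ((↑) : Sph n → Amb n)) (f := Prod.fst ∘ ψ) hc
      (mdifferentiableAt_fst.comp y hd) v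
    rw [h] at h'
    refine h'.symm.trans ?_
    rw [show ((↑) : Sph n → Amb n) ∘ (Prod.fst ∘ ψ) = sphParam x ∘ Prod.fst from rfl,
      mfderiv_eq_fderiv, fderiv_comp _ ((contDiff_sphParam x).differentiable (by simp) _)
        differentiableAt_fst, fderiv_fst]
    rfl
  change (y.2 ^ 2)⁻¹ * ((mfderiv 𝓘(ℝ, Mdl n × ℝ) ((𝓡 n).prod 𝓘(ℝ, ℝ)) ψ y v).2 *
    (mfderiv 𝓘(ℝ, Mdl n × ℝ) ((𝓡 n).prod 𝓘(ℝ, ℝ)) ψ y v').2 +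
    (1 - y.2 ^ 2 / 4) ^ 2 * @inner ℝ (Amb n) _
      (mfderiv (𝓡 n) 𝓘(ℝ, Amb n) ((↑) : Sph n → Amb n) (ψ y).1
        (mfderiv 𝓘(ℝ, Mdl n × ℝ) ((𝓡 n).prod 𝓘(ℝ, ℝ)) ψ y v).1)
      (mfderiv (𝓡 n) 𝓘(ℝ, Amb n) ((↑) : Sph n → Amb n) (ψ y).1
        (mfderiv 𝓘(ℝ, Mdl n × ℝ) ((𝓡 n).prod 𝓘(ℝ, ℝ)) ψ y v').1)) = _
  rw [h2, h2, h1, h1, inner_fderiv_sphParam]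

/-- The basis of `ℝⁿ × ℝ` in which the Laplacian of `g₊` is computed. -/
abbrev prodBasis (n : ℕ) : Module.Basis (Fin n ⊕ Unit) ℝ (Mdl n × ℝ) :=
  (EuclideanSpace.basisFun (Fin n) ℝ).toBasis.prod (Module.Basis.singleton Unit ℝ)

theorem metricComponents_spherePEMetric {n : ℕ} (x : Sph n) (r : ℝ) (y : Mdl n × ℝ) :
    metricComponents (I := (𝓡 n).prod 𝓘(ℝ, ℝ)) (prodBasis n) (spherePEMetric n) (x, r) y =
      Matrix.diagonal (Sum.elim
        (fun _ => (y.2 ^ 2)⁻¹ * ((1 - y.2 ^ 2 / 4) ^ 2 * (4 / (‖y.1‖ ^ 2 + 4)) ^ 2))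
        (fun _ => (y.2 ^ 2)⁻¹)) := by
  ext i j
  refine (spherePEMetric_mfderiv x r y (prodBasis n i) (prodBasis n j)).trans ?_
  rcases i with i | i <;> rcases j with j | j
  · simp [Matrix.diagonal_apply, EuclideanSpace.inner_single_left, PiLp.single_apply]
  · simp
  · simp
  · simp

/-! ### The Laplacian of `g₊` on separated functions. -/

/-- The function `f` on the sphere in the coordinates of the preferred chart at `x`. -/
def inChart {n : ℕ} (f : Sph n → ℂ) (x : Sph n) (w : Mdl n) : ℂ := f ((chartAt (Mdl n) x).symm w)

theorem contDiff_inChart {n : ℕ} (f : SmoothFn n) (x : Sph n) :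
    ContDiff ℝ ∞ (inChart (f : Sph n → ℂ) x) := by
  have h := contMDiffOn_extChartAt_symm (I := 𝓡 n) (n := ∞) x
  have ht : (extChartAt (𝓡 n) x).target = Set.univ := by
    have := Fact.mk (@finrank_euclideanSpace_fin ℝ _ (n + 1))
    have : (chartAt (Mdl n) x).target = Set.univ := stereographic'_target (-x)
    simp [extChartAt, OpenPartialHomeomorph.extend, this]
  rw [ht, contMDiffOn_univ] at h
  have hf : ContMDiff (𝓡 n) 𝓘(ℝ, ℂ) ∞ (f : Sph n → ℂ) := f.2
  exact (hf.comp h).contDiff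

theorem inChart_zero {n : ℕ} (f : Sph n → ℂ) (x : Sph n) : inChart f x 0 = f x := by
  rw [inChart, ← chartAt_sph_self x, OpenPartialHomeomorph.left_inv _ (mem_chart_source _ x)]

/-- The flat Laplacian at the centre of the preferred chart at `x`. -/
def chartLap {n : ℕ} (f : Sph n → ℂ) (x : Sph n) : ℂ :=
  ∑ i : Fin n, fderiv ℝ
    (fun w => fderiv ℝ (inChart f x) w (EuclideanSpace.basisFun (Fin n) ℝ i)) 0
    (EuclideanSpace.basisFun (Fin n) ℝ i)

theorem hasFDerivAt_sum_separated {E κ : Type*} [NormedAddCommGroup E] [NormedSpace ℝ E]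
    (S : Finset κ) {P : κ → E → ℂ} {Q Q' : κ → ℝ → ℂ} {y : E × ℝ}
    (hP : ∀ k ∈ S, DifferentiableAt ℝ (P k) y.1)
    (hQ : ∀ k ∈ S, HasDerivAt (Q k) (Q' k y.2) y.2) :
    ∃ D : E × ℝ →L[ℝ] ℂ, HasFDerivAt (fun y : E × ℝ => ∑ k ∈ S, Q k y.2 * P k y.1) D y ∧
      ∀ v, D v = ∑ k ∈ S, ((v.2 : ℂ) * Q' k y.2 * P k y.1 + Q k y.2 * fderiv ℝ (P k) y.1 v.1) := by
  have h : ∀ k ∈ S, HasFDerivAt (fun y : E × ℝ => Q k y.2 * P k y.1) _ y := fun k hk =>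
    ((hQ k hk).hasFDerivAt.comp y hasFDerivAt_snd).mul
      ((hP k hk).hasFDerivAt.comp y hasFDerivAt_fst)
  refine ⟨_, HasFDerivAt.fun_sum h, fun v => ?_⟩
  rw [sum_apply]
  refine Finset.sum_congr rfl fun k _ => ?_
  simp
  ring

/-- The conformal factor of the stereographic chart. -/
def stereoFactor {n : ℕ} (w : Mdl n) : ℝ := 4 / (‖w‖ ^ 2 + 4)

theorem stereoFactor_pos {n : ℕ} (w : Mdl n) : 0 < stereoFactor w := by
  unfold stereoFactor; positivity

theorem stereoFactor_zero {n : ℕ} : stereoFactor (0 : Mdl n) = 1 := by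
  simp [stereoFactor]

/-- The factor depends on `‖w‖²` only, so the centre of the chart is a critical point. Powers of it
therefore create no first-order terms there, and the spherical Laplacian at the centre is the flat
`chartLap`. -/
theorem hasFDerivAt_stereoFactor_zero {n : ℕ} :
    HasFDerivAt (stereoFactor : Mdl n → ℝ) (0 : Mdl n →L[ℝ] ℝ) 0 := by
  have h1 : HasFDerivAt (fun w : Mdl n => ‖w‖ ^ 2) (2 • innerSL ℝ (0 : Mdl n)) 0 :=
    (hasStrictFDerivAt_norm_sq 0).hasFDerivAt
  have hne : ‖(0 : Mdl n)‖ ^ 2 + 4 ≠ 0 := by positivity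
  have h2 := ((hasFDerivAt_inv hne).comp (0 : Mdl n) (h1.add_const 4)).const_mul 4
  refine (h2.congr_fderiv ?_).congr_of_eventuallyEq (Eventually.of_forall fun w => ?_)
  · ext; simp
  · simp [stereoFactor, div_eq_mul_inv]

theorem hasFDerivAt_comp_stereoFactor_zero {n : ℕ} {h : ℝ → ℝ} (hh : DifferentiableAt ℝ h 1) :
    HasFDerivAt (fun w : Mdl n => h (stereoFactor w)) (0 : Mdl n →L[ℝ] ℝ) 0 := by
  rw [← stereoFactor_zero (n := n)] at hh
  exact (hh.hasFDerivAt.comp (0 : Mdl n) hasFDerivAt_stereoFactor_zero).congr_fderiv (by simp)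

/-- The volume density of `g₊` at the centre of the charts. -/
def radialDensity (n : ℕ) (s : ℝ) : ℝ := (s⁻¹ * (1 - s ^ 2 / 4)) ^ n * s⁻¹

theorem radialDensity_pos {n : ℕ} {s : ℝ} (h0 : 0 < s) (h2 : s < 2) : 0 < radialDensity n s := by
  have : 0 < 1 - s ^ 2 / 4 := by nlinarith
  unfold radialDensity
  positivity

theorem sqrt_det_metricComponents {n : ℕ} (x : Sph n) (r : ℝ) {y : Mdl n × ℝ} (h0 : 0 < y.2)
    (h2 : y.2 < 2) :
    Real.sqrt (metricComponents (I := (𝓡 n).prod 𝓘(ℝ, ℝ)) (prodBasis n)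
      (spherePEMetric n) (x, r) y).det = radialDensity n y.2 * stereoFactor y.1 ^ n := by
  have hσ := stereoFactor_pos y.1
  have hω := radialDensity_pos (n := n) h0 h2
  rw [metricComponents_spherePEMetric, Matrix.det_diagonal]
  simp only [Fintype.prod_sum_type, Sum.elim_inl, Sum.elim_inr, Finset.prod_const,
    Finset.card_univ, Fintype.card_fin, Fintype.card_unit, pow_one]
  rw [Real.sqrt_eq_iff_mul_self_eq (by positivity) (by positivity), radialDensity, stereoFactor]
  generalize 1 - y.2 ^ 2 / 4 = a
  generalize 4 / (‖y.1‖ ^ 2 + 4) = b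
  ring

theorem inv_metricComponents {n : ℕ} (x : Sph n) (r : ℝ) {y : Mdl n × ℝ} (h0 : 0 < y.2)
    (h2 : y.2 < 2) :
    (metricComponents (I := (𝓡 n).prod 𝓘(ℝ, ℝ)) (prodBasis n)
      (spherePEMetric n) (x, r) y)⁻¹ = Matrix.diagonal (Sum.elim
        (fun _ => y.2 ^ 2 * ((1 - y.2 ^ 2 / 4) ^ 2)⁻¹ * (stereoFactor y.1 ^ 2)⁻¹)
        (fun _ => y.2 ^ 2)) := by
  have hσ := stereoFactor_pos y.1
  have hρ : 0 < 1 - y.2 ^ 2 / 4 := by nlinarith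
  have hρ' : 4 - y.2 ^ 2 ≠ 0 := by linarith
  rw [metricComponents_spherePEMetric]
  refine Matrix.inv_eq_right_inv ?_
  rw [Matrix.diagonal_mul_diagonal, ← Matrix.diagonal_one]
  congr 1
  ext (i | i)
  · simp only [Sum.elim_inl]
    rw [← stereoFactor]
    field_simp
  · simp only [Sum.elim_inr]
    field_simp

theorem hasDerivAt_radialDensity {n : ℕ} {s : ℝ} (h0 : 0 < s) (h2 : s < 2) :
    HasDerivAt (radialDensity n)
      (radialDensity n s * (-(n + 1) / s - n * (s / 2) / (1 - s ^ 2 / 4))) s := by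
  have hρ : 0 < 1 - s ^ 2 / 4 := by nlinarith
  have hρ' : 4 - s ^ 2 ≠ 0 := by linarith
  have h1 := (hasDerivAt_inv h0.ne').mul (((hasDerivAt_pow 2 s).div_const 4).const_sub 1)
  have h := (h1.pow n).mul (hasDerivAt_inv h0.ne')
  refine h.congr_deriv ?_
  simp only [radialDensity, Pi.mul_apply, Pi.pow_apply]
  -- The derivative of the `n`-th power carries the truncated exponent `n - 1`, so `n = 0` is
  -- treated apart.
  rcases n with _ | m
  · simp; field_simp
  · simp only [Nat.add_sub_cancel, pow_succ]
    generalize (s⁻¹ * (1 - s ^ 2 / 4)) ^ m = c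
    push_cast
    field_simp
    ring

/-- The Laplacian of `g₊` on finite sums of products of functions of `r` and on the sphere. -/
theorem lapPE_sum_separated {n : ℕ} {κ : Type*} (S : Finset κ) {g g' g'' : κ → ℝ → ℂ}
    (A : κ → SmoothFn n)
    (hg : ∀ k ∈ S, ∀ s, 0 < s → HasDerivAt (g k) (g' k s) s)
    (hg' : ∀ k ∈ S, ∀ s, 0 < s → HasDerivAt (g' k) (g'' k s) s)
    (x : Sph n) {r : ℝ} (h0 : 0 < r) (h2 : r < 2) :
    lapPE n (fun q => ∑ k ∈ S, g k q.2 * (A k : Sph n → ℂ) q.1) (x, r) =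
      ∑ k ∈ S, ((r ^ 2 * g'' k r + (1 - n) * r * g' k r
          - n / 2 * r ^ 3 / (1 - r ^ 2 / 4) * g' k r) * (A k : Sph n → ℂ) x
        + r ^ 2 / (1 - r ^ 2 / 4) ^ 2 * g k r * chartLap (A k : Sph n → ℂ) x) := by
  set u : Sph n × ℝ → ℂ := fun q => ∑ k ∈ S, g k q.2 * (A k : Sph n → ℂ) q.1 with hu
  set U : Mdl n × ℝ → ℂ := fun y => ∑ k ∈ S, g k y.2 * inChart (A k : Sph n → ℂ) x y.1 with hU
  have hAd : ∀ k, ContDiff ℝ ∞ (inChart (A k : Sph n → ℂ) x) := fun k => contDiff_inChart _ _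
  have hfd : ∀ y : Mdl n × ℝ, 0 < y.2 → ∀ v, fderiv ℝ U y v = ∑ k ∈ S,
      ((v.2 : ℂ) * g' k y.2 * inChart (A k : Sph n → ℂ) x y.1
        + g k y.2 * fderiv ℝ (inChart (A k : Sph n → ℂ) x) y.1 v.1) := by
    intro y hy v
    obtain ⟨D, hD, hDv⟩ := hasFDerivAt_sum_separated S (y := y)
      (fun k _ => (hAd k).differentiable (by simp) y.1) (fun k hk => hg k hk y.2 hy)
    rw [hD.fderiv, hDv]
  have hnear : ∀ᶠ y : Mdl n × ℝ in 𝓝 (0, r), 0 < y.2 ∧ y.2 < 2 :=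
    (continuous_snd.tendsto ((0 : Mdl n), r)).eventually (Ioo_mem_nhds h0 h2)
  have hρ : 0 < 1 - r ^ 2 / 4 := by nlinarith
  have hω := radialDensity_pos (n := n) h0 h2
  have hlap : lapPE n u (x, r) = (radialDensity n r)⁻¹ • ∑ i, fderiv ℝ (fun y : Mdl n × ℝ =>
      ∑ j, (Real.sqrt (metricComponents (I := (𝓡 n).prod 𝓘(ℝ, ℝ)) (prodBasis n)
        (spherePEMetric n) (x, r) y).det *
      (metricComponents (I := (𝓡 n).prod 𝓘(ℝ, ℝ)) (prodBasis n)
        (spherePEMetric n) (x, r) y)⁻¹ i j) • fderiv ℝ U y (prodBasis n j)) (0, r)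
        (prodBasis n i) := by
    rw [lapPE, laplaceBeltrami, extChartAt_sph_prod_self,
      sqrt_det_metricComponents (y := ((0 : Mdl n), r)) x r h0 h2]
    simp only [stereoFactor_zero, one_pow, mul_one]
    rfl
  -- Tangential directions: the metric is diagonal, so only `j = i` survives, and the conformal
  -- factor is stationary with value `1` at the centre.
  have hinl : ∀ i : Fin n, fderiv ℝ (fun y : Mdl n × ℝ =>
      ∑ j, (Real.sqrt (metricComponents (I := (𝓡 n).prod 𝓘(ℝ, ℝ)) (prodBasis n)
        (spherePEMetric n) (x, r) y).det *
      (metricComponents (I := (𝓡 n).prod 𝓘(ℝ, ℝ)) (prodBasis n)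
        (spherePEMetric n) (x, r) y)⁻¹ (Sum.inl i) j) • fderiv ℝ U y (prodBasis n j)) (0, r)
        (prodBasis n (Sum.inl i)) = ∑ k ∈ S,
          (((radialDensity n r * (r ^ 2 * ((1 - r ^ 2 / 4) ^ 2)⁻¹) : ℝ) : ℂ) * g k r) *
          fderiv ℝ (fun w => fderiv ℝ (inChart (A k : Sph n → ℂ) x) w
            (EuclideanSpace.basisFun (Fin n) ℝ i)) 0 (EuclideanSpace.basisFun (Fin n) ℝ i) := by
    intro i
    set e := EuclideanSpace.basisFun (Fin n) ℝ i with he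
    have hev : (fun y : Mdl n × ℝ =>
      ∑ j, (Real.sqrt (metricComponents (I := (𝓡 n).prod 𝓘(ℝ, ℝ)) (prodBasis n)
        (spherePEMetric n) (x, r) y).det *
      (metricComponents (I := (𝓡 n).prod 𝓘(ℝ, ℝ)) (prodBasis n)
        (spherePEMetric n) (x, r) y)⁻¹ (Sum.inl i) j) • fderiv ℝ U y (prodBasis n j)) =ᶠ[𝓝 (0, r)]
        fun y => ∑ k ∈ S, (((radialDensity n y.2 * (y.2 ^ 2 * ((1 - y.2 ^ 2 / 4) ^ 2)⁻¹) : ℝ) : ℂ)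
          * g k y.2) *
          (((stereoFactor y.1 ^ n * (stereoFactor y.1 ^ 2)⁻¹ : ℝ) : ℂ) *
            fderiv ℝ (inChart (A k : Sph n → ℂ) x) y.1 e) := by
      filter_upwards [hnear] with y hy
      rw [Finset.sum_eq_single (Sum.inl i)]
      · rw [sqrt_det_metricComponents x r hy.1 hy.2, inv_metricComponents x r hy.1 hy.2,
          hfd y hy.1, Complex.real_smul, Finset.mul_sum]
        refine Finset.sum_congr rfl fun k _ => ?_
        simp [he]
        ring
      · intro j _ hj
        rw [inv_metricComponents x r hy.1 hy.2, Matrix.diagonal_apply_ne _ hj.symm]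
        simp
      · simp
    have hβ : HasFDerivAt (fun w : Mdl n =>
        ((stereoFactor w ^ n * (stereoFactor w ^ 2)⁻¹ : ℝ) : ℂ)) (0 : Mdl n →L[ℝ] ℂ) 0 := by
      have := hasFDerivAt_comp_stereoFactor_zero (n := n) (h := fun t => t ^ n * (t ^ 2)⁻¹)
        (by fun_prop (disch := norm_num))
      exact (Complex.ofRealCLM.hasFDerivAt.comp (0 : Mdl n) this).congr_fderiv (by ext; simp)
    have hA2 : ∀ k, DifferentiableAt ℝ (fun w => fderiv ℝ (inChart (A k : Sph n → ℂ) x) w e) 0 :=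
      fun k => (((hAd k).fderiv_right (m := 1) (by norm_cast)).differentiable (by simp) 0).clm_apply
        (differentiableAt_const e)
    have hP : ∀ k, HasFDerivAt (fun w : Mdl n =>
        ((stereoFactor w ^ n * (stereoFactor w ^ 2)⁻¹ : ℝ) : ℂ) *
            fderiv ℝ (inChart (A k : Sph n → ℂ) x) w e)
        (fderiv ℝ (fun w => fderiv ℝ (inChart (A k : Sph n → ℂ) x) w e) 0) 0 := fun k =>
      (hβ.mul (hA2 k).hasFDerivAt).congr_fderiv (by ext v; simp [stereoFactor_zero])
    have hQ : ∀ k ∈ S, DifferentiableAt ℝ (fun s : ℝ =>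
        (((radialDensity n s * (s ^ 2 * ((1 - s ^ 2 / 4) ^ 2)⁻¹) : ℝ) : ℂ) * g k s)) r := by
      intro k hk
      have h1 : DifferentiableAt ℝ
          (fun s : ℝ => radialDensity n s * (s ^ 2 * ((1 - s ^ 2 / 4) ^ 2)⁻¹)) r :=
        (hasDerivAt_radialDensity h0 h2).differentiableAt.mul
          (by fun_prop (disch := positivity))
      exact (Complex.ofRealCLM.differentiableAt.comp r h1).mul (hg k hk r h0).differentiableAt
    obtain ⟨D, hD, hDv⟩ := hasFDerivAt_sum_separated S (y := ((0 : Mdl n), r))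
      (fun k _ => (hP k).differentiableAt)
      (Q' := fun k => deriv (fun s : ℝ =>
        (((radialDensity n s * (s ^ 2 * ((1 - s ^ 2 / 4) ^ 2)⁻¹) : ℝ) : ℂ) * g k s)))
      (fun k hk => (hQ k hk).hasDerivAt)
    rw [hev.fderiv_eq, hD.fderiv, hDv]
    refine Finset.sum_congr rfl fun k _ => ?_
    rw [(hP k).fderiv]
    simp [he]
  -- Radial direction: the logarithmic derivative of the density produces the first-order terms in
  -- `r`.
  have hinr : fderiv ℝ (fun y : Mdl n × ℝ =>
      ∑ j, (Real.sqrt (metricComponents (I := (𝓡 n).prod 𝓘(ℝ, ℝ)) (prodBasis n)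
        (spherePEMetric n) (x, r) y).det *
      (metricComponents (I := (𝓡 n).prod 𝓘(ℝ, ℝ)) (prodBasis n)
        (spherePEMetric n) (x, r) y)⁻¹ (Sum.inr ()) j) • fderiv ℝ U y (prodBasis n j)) (0, r)
        (prodBasis n (Sum.inr ())) = ∑ k ∈ S,
          (radialDensity n r : ℂ) * (r ^ 2 * g'' k r + (1 - n) * r * g' k r
          - n / 2 * r ^ 3 / (1 - r ^ 2 / 4) * g' k r) * (A k : Sph n → ℂ) x := by
    have hev : (fun y : Mdl n × ℝ =>
      ∑ j, (Real.sqrt (metricComponents (I := (𝓡 n).prod 𝓘(ℝ, ℝ)) (prodBasis n)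
        (spherePEMetric n) (x, r) y).det *
      (metricComponents (I := (𝓡 n).prod 𝓘(ℝ, ℝ)) (prodBasis n)
        (spherePEMetric n) (x, r) y)⁻¹ (Sum.inr ()) j) • fderiv ℝ U y (prodBasis n j))
        =ᶠ[𝓝 (0, r)]
        fun y => ∑ k ∈ S, (((radialDensity n y.2 * y.2 ^ 2 : ℝ) : ℂ) * g' k y.2) *
          (((stereoFactor y.1 ^ n : ℝ) : ℂ) * inChart (A k : Sph n → ℂ) x y.1) := by
      filter_upwards [hnear] with y hy
      rw [Finset.sum_eq_single (Sum.inr ())]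
      · rw [sqrt_det_metricComponents x r hy.1 hy.2, inv_metricComponents x r hy.1 hy.2,
          hfd y hy.1, Complex.real_smul, Finset.mul_sum]
        refine Finset.sum_congr rfl fun k _ => ?_
        simp
        ring
      · intro j _ hj
        rw [inv_metricComponents x r hy.1 hy.2, Matrix.diagonal_apply_ne _ hj.symm]
        simp
      · simp
    have hP : ∀ k, DifferentiableAt ℝ (fun w : Mdl n =>
        ((stereoFactor w ^ n : ℝ) : ℂ) * inChart (A k : Sph n → ℂ) x w) 0 := by
      intro k
      have := hasFDerivAt_comp_stereoFactor_zero (n := n) (h := fun t => t ^ n) (by fun_prop)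
      exact (Complex.ofRealCLM.differentiableAt.comp (0 : Mdl n) this.differentiableAt).mul
        ((hAd k).differentiable (by simp) 0)
    have hQ : ∀ k ∈ S, HasDerivAt (fun s : ℝ =>
        (((radialDensity n s * s ^ 2 : ℝ) : ℂ) * g' k s))
        ((radialDensity n r : ℂ) * (r ^ 2 * g'' k r + (1 - n) * r * g' k r
          - n / 2 * r ^ 3 / (1 - r ^ 2 / 4) * g' k r)) r := by
      intro k hk
      have h1 := ((hasDerivAt_radialDensity (n := n) h0 h2).mul (hasDerivAt_pow 2 r)).ofReal_comp
      refine (h1.mul (hg' k hk r h0)).congr_deriv ?_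
      have hr' : (r : ℂ) ≠ 0 := by exact_mod_cast h0.ne'
      have hρ' : (1 - (r : ℂ) ^ 2 / 4) ≠ 0 := by exact_mod_cast hρ.ne'
      have hρ'' : (4 - (r : ℂ) ^ 2) ≠ 0 := by
        intro h; apply hρ'; linear_combination h / 4
      simp
      field_simp
      ring
    obtain ⟨D, hD, hDv⟩ := hasFDerivAt_sum_separated S (y := ((0 : Mdl n), r))
      (fun k _ => hP k) (Q' := fun k r => (radialDensity n r : ℂ) * (r ^ 2 * g'' k r
          + (1 - n) * r * g' k r - n / 2 * r ^ 3 / (1 - r ^ 2 / 4) * g' k r)) hQ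
    rw [hev.fderiv_eq, hD.fderiv, hDv]
    refine Finset.sum_congr rfl fun k _ => ?_
    simp [stereoFactor_zero, inChart_zero]
  have hω' : (radialDensity n r : ℂ) ≠ 0 := by exact_mod_cast hω.ne'
  rw [hlap, Fintype.sum_sum_type]
  simp only [hinl]
  have hunit : ∀ F : Unit → ℂ, ∑ a, F a = F () := fun F => Fintype.sum_unique F
  rw [hunit, hinr, Finset.sum_comm,
    ← Finset.sum_add_distrib, Complex.real_smul, Finset.mul_sum]
  refine Finset.sum_congr rfl fun k _ => ?_
  rw [← Finset.mul_sum, ← chartLap]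
  push_cast
  field_simp
  ring

/-! ### The sphere Laplacian through homogeneous extensions. -/

open Classical in
/-- The extension of a function on the sphere to a function on `ℝⁿ⁺¹ \ {0}` that is homogeneous
of degree `0`. -/
def homExt {n : ℕ} (f : Sph n → ℂ) (y : Amb n) : ℂ :=
  if h : y ≠ 0 then f ⟨‖y‖⁻¹ • y, by simp [norm_smul, h]⟩ else 0

theorem homExt_coe {n : ℕ} (f : Sph n → ℂ) (x : Sph n) : homExt f x = f x := by
  rw [homExt, dif_pos (ne_zero_of_mem_unit_sphere x)]
  congr 1
  ext1
  simp

theorem homExt_smul {n : ℕ} (f : Sph n → ℂ) {t : ℝ} (ht : 0 < t) (y : Amb n) :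
    homExt f (t • y) = homExt f y := by
  by_cases hy : y = 0
  · simp [hy]
  · rw [homExt, homExt, dif_pos hy, dif_pos (smul_ne_zero ht.ne' hy)]
    congr 2
    rw [norm_smul, Real.norm_of_nonneg ht.le, smul_smul]
    congr 1
    field_simp

theorem inChart_eq_homExt {n : ℕ} (f : Sph n → ℂ) (x : Sph n) :
    inChart f x = homExt f ∘ sphParam x := by
  ext w
  exact (homExt_coe f _).symm

/-- Near `y` the extension is a composite of smooth maps: normalization, the stereographic chart
centred at `y / ‖y‖`, and `f` read in that chart. -/
theorem contDiffAt_homExt {n : ℕ} (f : SmoothFn n) {y : Amb n} (hy : y ≠ 0) :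
    ContDiffAt ℝ ∞ (homExt (f : Sph n → ℂ)) y := by
  have := Fact.mk (@finrank_euclideanSpace_fin ℝ _ (n + 1))
  set x : Sph n := ⟨‖y‖⁻¹ • y, by simp [norm_smul, hy]⟩ with hx
  let U := (OrthonormalBasis.fromOrthogonalSpanSingleton (𝕜 := ℝ) n
    (ne_zero_of_mem_unit_sphere (-x))).repr
  have hproj : ContDiffAt ℝ ∞ (fun z : Amb n => ‖z‖⁻¹ • z) y :=
    ((contDiffAt_norm ℝ hy).inv (norm_ne_zero_iff.2 hy)).fun_smul contDiffAt_id
  have hopen : IsOpen {z : Amb n | innerSL ℝ ((-x : Sph n) : Amb n) z ≠ 1} :=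
    isOpen_ne_fun (by fun_prop) continuous_const
  have hmem : ‖y‖⁻¹ • y ∈ {z : Amb n | innerSL ℝ ((-x : Sph n) : Amb n) z ≠ 1} := by
    have h1 : ⟪(x : Amb n), (x : Amb n)⟫ = 1 := by simp
    change ⟪((-x : Sph n) : Amb n), (x : Amb n)⟫ ≠ 1
    rw [coe_neg_sphere, inner_neg_left, h1]
    norm_num
  have hst : ContDiffAt ℝ ∞ (stereoToFun ((-x : Sph n) : Amb n)) (‖y‖⁻¹ • y) :=
    contDiffOn_stereoToFun.contDiffAt (hopen.mem_nhds hmem)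
  have hcomp : ContDiffAt ℝ ∞ (fun z : Amb n => inChart (f : Sph n → ℂ) x
      (U (stereoToFun ((-x : Sph n) : Amb n) (‖z‖⁻¹ • z)))) y :=
    (contDiff_inChart f x).contDiffAt.comp y
      (U.contDiff.contDiffAt.comp y
        (ContDiffAt.comp (g := stereoToFun ((-x : Sph n) : Amb n)) y hst hproj))
  refine hcomp.congr_of_eventuallyEq ?_
  filter_upwards [hproj.continuousAt.preimage_mem_nhds (hopen.mem_nhds hmem),
    isOpen_ne.mem_nhds hy] with z hz hz0
  rw [homExt, dif_pos hz0]
  set p : Sph n := ⟨‖z‖⁻¹ • z, by simp [norm_smul, show z ≠ 0 from hz0]⟩ with hp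
  have hsrc : p ∈ (chartAt (Mdl n) x).source := by
    change p ∈ (stereographic' n (-x)).source
    rw [stereographic'_source]
    intro h
    rw [Set.mem_singleton_iff] at h
    have h1 : ⟪((-x : Sph n) : Amb n), (p : Amb n)⟫ = 1 := by rw [h]; simp
    exact hz h1
  exact congrArg (f : Sph n → ℂ) ((chartAt (Mdl n) x).left_inv hsrc).symm

theorem fderiv_homExt_self {n : ℕ} (f : SmoothFn n) {y : Amb n} (hy : y ≠ 0) :
    fderiv ℝ (homExt (f : Sph n → ℂ)) y y = 0 := by
  have h1 : HasDerivAt (fun t : ℝ => t • y) y 1 := by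
    simpa using (hasDerivAt_id (1 : ℝ)).smul_const y
  have h2 : HasFDerivAt (homExt (f : Sph n → ℂ)) (fderiv ℝ (homExt (f : Sph n → ℂ)) y)
      ((1 : ℝ) • y) := by
    rw [one_smul]
    exact ((contDiffAt_homExt f hy).differentiableAt (by simp)).hasFDerivAt
  have h3 := h2.comp_hasDerivAt (1 : ℝ) h1
  have h4 : HasDerivAt (homExt (f : Sph n → ℂ) ∘ fun t : ℝ => t • y) 0 1 := by
    refine (hasDerivAt_const (1 : ℝ) (homExt (f : Sph n → ℂ) y)).congr_of_eventuallyEq ?_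
    filter_upwards [lt_mem_nhds (zero_lt_one (α := ℝ))] with t ht
    exact homExt_smul _ ht y
  exact h3.unique h4

theorem differentiableAt_fderiv_homExt {n : ℕ} (f : SmoothFn n) {y : Amb n} (hy : y ≠ 0) :
    DifferentiableAt ℝ (fderiv ℝ (homExt (f : Sph n → ℂ))) y :=
  ((contDiffAt_homExt f hy).fderiv_right (m := 1) (by norm_cast)).differentiableAt (by simp)

/-- Euler's relation `DF(z) z = 0`, differentiated at `y` in the direction `y`, reads `D²F(y)(y, y)
+ DF(y) y = 0`. -/
theorem fderiv_fderiv_homExt_self {n : ℕ} (f : SmoothFn n) {y : Amb n} (hy : y ≠ 0) :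
    fderiv ℝ (fderiv ℝ (homExt (f : Sph n → ℂ))) y y y = 0 := by
  have h1 := (differentiableAt_fderiv_homExt f hy).hasFDerivAt.clm_apply (hasFDerivAt_id y)
  have h2 : HasFDerivAt (fun z => fderiv ℝ (homExt (f : Sph n → ℂ)) z (id z))
      (0 : Amb n →L[ℝ] ℂ) y := by
    refine (hasFDerivAt_const (0 : ℂ) y).congr_of_eventuallyEq ?_
    filter_upwards [isOpen_ne.mem_nhds hy] with z hz
    exact fderiv_homExt_self f hz
  have h3 := congrArg (fun D : Amb n →L[ℝ] ℂ => D y) (h1.unique h2)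
  simpa [fderiv_homExt_self f hy] using h3

/-- The Laplacian of the homogeneous extension. -/
def extLap {n : ℕ} (f : Sph n → ℂ) (y : Amb n) : ℂ :=
  (Laplacian.laplacian (homExt f) : Amb n → ℂ) y

theorem extLap_eq_sum {n : ℕ} (f : Sph n → ℂ) (y : Amb n) {ι : Type*} [Fintype ι]
    (b : OrthonormalBasis ι ℝ (Amb n)) :
    extLap f y = ∑ i, fderiv ℝ (fderiv ℝ (homExt f)) y (b i) (b i) := by
  rw [extLap, InnerProductSpace.laplacian_eq_iteratedFDeriv_orthonormalBasis _ b]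
  refine Finset.sum_congr rfl fun i _ => ?_
  rw [iteratedFDeriv_two_apply]
  rfl

/-- The line `t • e` maps to a great circle whose speed `4 / (t² + 4)` is stationary with value `1`
at `t = 0`, so the acceleration is purely centripetal. -/
theorem fderiv_fderiv_sphParam_zero {n : ℕ} {x : Sph n} {J : Mdl n →ₗᵢ[ℝ] Amb n}
    (hJ : ∀ w, sphParam x w =
        (‖w‖ ^ 2 + 4)⁻¹ • ((4 : ℝ) • J w + (4 - ‖w‖ ^ 2) • (x : Amb n)))
    {e : Mdl n} (he : ‖e‖ = 1) :
    fderiv ℝ (fun w => fderiv ℝ (sphParam x) w e) 0 e = -(x : Amb n) := by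
  have hd : DifferentiableAt ℝ (fun w => fderiv ℝ (sphParam x) w e) ((0 : ℝ) • e) :=
    (((contDiff_sphParam x).of_le le_top : ContDiff ℝ 2 (sphParam x)).fderiv_right (m := 1)
      (by norm_num)).differentiable (by simp) _ |>.clm_apply (differentiableAt_const e)
  have h1 : HasDerivAt (fun t : ℝ => t • e) e 0 := by
    simpa using (hasDerivAt_id (0 : ℝ)).smul_const e
  have h2 := hd.hasFDerivAt.comp_hasDerivAt (0 : ℝ) h1
  rw [zero_smul] at h2
  have h3 : HasDerivAt (fun t : ℝ => (4 * (t ^ 2 + 4)⁻¹ - 8 * t ^ 2 * ((t ^ 2 + 4)⁻¹) ^ 2) • J e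
      - (16 * t * ((t ^ 2 + 4)⁻¹) ^ 2) • (x : Amb n)) (-(x : Amb n)) 0 := by
    have h4 : HasDerivAt (fun t : ℝ => (t ^ 2 + 4)⁻¹) 0 0 := by
      simpa using ((hasDerivAt_pow 2 (0 : ℝ)).add_const 4).fun_inv (by norm_num)
    have h5 := (((h4.const_mul 4).sub (((hasDerivAt_pow 2 (0 : ℝ)).const_mul 8).mul
      (h4.pow 2))).smul_const (J e)).sub
      ((((hasDerivAt_id (0 : ℝ)).const_mul 16).mul (h4.pow 2)).smul_const (x : Amb n))
    refine h5.congr_deriv ?_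
    norm_num
  refine h2.unique (h3.congr_of_eventuallyEq (Eventually.of_forall fun t => ?_))
  have hn : ‖t • e‖ ^ 2 = t ^ 2 := by rw [norm_smul, he, mul_one, Real.norm_eq_abs, sq_abs]
  have hi : ⟪t • e, e⟫ = t := by
    rw [real_inner_smul_left, real_inner_self_eq_norm_sq, he]; ring
  simp only [Function.comp_apply, fderiv_sphParam_apply hJ, hn, hi, map_smul]
  match_scalars <;> ring

/-- By the chain rule each second chart derivative is `D²F(J e, J e)` plus `DF` applied to the
acceleration `-x`, which vanishes by Euler's relation. The missing direction `x` adds nothing to the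
full Laplacian because the second radial derivative of `F` is zero. -/
theorem chartLap_eq_extLap {n : ℕ} (f : SmoothFn n) (x : Sph n) :
    chartLap (f : Sph n → ℂ) x = extLap (f : Sph n → ℂ) x := by
  obtain ⟨J, hx, hJ⟩ := exists_sphParam_eq x
  have hx0 : (x : Amb n) ≠ 0 := ne_zero_of_mem_unit_sphere x
  set F := homExt (f : Sph n → ℂ) with hF
  set e := EuclideanSpace.basisFun (Fin n) ℝ with he
  have hψ0 : sphParam x 0 = x := by rw [hJ]; simp [smul_smul]
  have hψne : ∀ w, sphParam x w ≠ 0 := fun w => ne_zero_of_mem_unit_sphere _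
  have hψ : ContDiff ℝ 2 (sphParam x) := (contDiff_sphParam x).of_le le_top
  have hterm : ∀ i, fderiv ℝ (fun w => fderiv ℝ (inChart (f : Sph n → ℂ) x) w (e i)) 0 (e i) =
      fderiv ℝ (fderiv ℝ F) x (J (e i)) (J (e i)) := by
    intro i
    have h1 : (fun w => fderiv ℝ (inChart (f : Sph n → ℂ) x) w (e i)) =
        fun w => fderiv ℝ F (sphParam x w) (fderiv ℝ (sphParam x) w (e i)) := by
      ext w
      rw [inChart_eq_homExt, fderiv_comp _
        ((contDiffAt_homExt f (hψne w)).differentiableAt (by simp))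
        (hψ.differentiable (by norm_num) w)]
      rfl
    have h2 : HasFDerivAt (fun w => fderiv ℝ F (sphParam x w)) _ 0 :=
      ((differentiableAt_fderiv_homExt f (hψne 0)).hasFDerivAt).comp (0 : Mdl n)
        (hψ.differentiable (by norm_num) 0).hasFDerivAt
    have h3 : HasFDerivAt (fun w => fderiv ℝ (sphParam x) w (e i)) _ 0 :=
      ((hψ.fderiv_right (m := 1) (by norm_num)).differentiable (by simp) 0 |>.clm_apply
        (differentiableAt_const (e i))).hasFDerivAt
    have hD : fderiv ℝ (sphParam x) 0 (e i) = J (e i) := by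
      rw [fderiv_sphParam_apply hJ]
      simp [smul_smul]
    rw [h1, (h2.clm_apply h3).fderiv]
    simp only [add_apply, ContinuousLinearMap.comp_apply,
      ContinuousLinearMap.flip_apply]
    rw [fderiv_fderiv_sphParam_zero hJ (e.norm_eq_one i), hD, hψ0, map_neg,
      fderiv_homExt_self f hx0, neg_zero, zero_add]
  let v : Option (Fin n) → Amb n := fun o => o.elim (x : Amb n) fun i => J (e i)
  have hv : Orthonormal ℝ v := by
    refine ⟨?_, ?_⟩
    · rintro (_ | i)
      · simp [v]
      · simp [v, he]
    · rintro (_ | i) (_ | j) hij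
      · exact absurd rfl hij
      · exact hx _
      · exact (real_inner_comm _ _).trans (hx _)
      · change ⟪J (e i), J (e j)⟫ = 0
        rw [J.inner_map_map]
        exact e.orthonormal.2 fun h => hij (by rw [h])
  -- The orthonormal family already has `n + 1` members, so with `s = univ` the extension is the
  -- family itself, now as a basis.
  obtain ⟨b, hb⟩ := Orthonormal.exists_orthonormalBasis_extension_of_card_eq (𝕜 := ℝ)
    (E := Amb n) (ι := Option (Fin n)) (v := v) (s := Set.univ) (by simp)
    (hv.comp _ Subtype.val_injective)
  rw [extLap_eq_sum _ _ b, Fintype.sum_option, hb _ (Set.mem_univ _), chartLap]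
  change _ = fderiv ℝ (fderiv ℝ F) x x x + _
  rw [fderiv_fderiv_homExt_self f hx0, zero_add]
  refine Finset.sum_congr rfl fun i _ => ?_
  rw [hb _ (Set.mem_univ _)]
  exact hterm i

theorem contDiffAt_extLap {n : ℕ} (f : SmoothFn n) {y : Amb n} (hy : y ≠ 0) :
    ContDiffAt ℝ ∞ (extLap (f : Sph n → ℂ)) y := by
  rw [show extLap (f : Sph n → ℂ) = _ from
    funext fun y => extLap_eq_sum _ y (EuclideanSpace.basisFun (Fin (n + 1)) ℝ)]
  refine ContDiffAt.sum fun i _ => ?_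
  have h := ((contDiffAt_homExt f hy).fderiv_right (m := ∞) (by norm_cast)).fderiv_right
    (m := ∞) (by norm_cast)
  exact (h.clm_apply contDiffAt_const).clm_apply contDiffAt_const

theorem homExt_add {n : ℕ} (f g : Sph n → ℂ) : homExt (f + g) = homExt f + homExt g := by
  ext y
  by_cases hy : y = 0 <;> simp [homExt, hy]

/-- The Laplacian of the round sphere on smooth functions. -/
def sphLap (n : ℕ) : SmoothOp n where
  toFun f := ⟨chartLap (f : Sph n → ℂ), by
    intro x
    have := Fact.mk (@finrank_euclideanSpace_fin ℝ _ (n + 1))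
    -- The chart in `chartLap` moves with `x`; smoothness in `x` is read off from the restriction of
    -- `extLap`, which involves no chart.
    have h : ContMDiffAt 𝓘(ℝ, Amb n) 𝓘(ℝ, ℂ) ∞ (extLap (f : Sph n → ℂ)) (x : Amb n) :=
      (contDiffAt_extLap f (ne_zero_of_mem_unit_sphere x)).contMDiffAt
    refine (h.comp x (contMDiff_coe_sphere x)).congr_of_eventuallyEq ?_
    exact Eventually.of_forall fun x => chartLap_eq_extLap f x⟩
  map_add' f g := by
    ext x
    have hx := ne_zero_of_mem_unit_sphere x
    change chartLap ((f + g : SmoothFn n) : Sph n → ℂ) x =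
      chartLap (f : Sph n → ℂ) x + chartLap (g : Sph n → ℂ) x
    rw [chartLap_eq_extLap, chartLap_eq_extLap, chartLap_eq_extLap, extLap, Submodule.coe_add,
      homExt_add]
    exact ((contDiffAt_homExt f hx).of_le (by norm_cast)).laplacian_add
      ((contDiffAt_homExt g hx).of_le (by norm_cast))
  map_smul' c f := by
    ext x
    change chartLap ((c • f : SmoothFn n) : Sph n → ℂ) x = c * chartLap (f : Sph n → ℂ) x
    simp only [chartLap, Finset.mul_sum]
    refine Finset.sum_congr rfl fun i _ => ?_
    have h1 : inChart ((c • f : SmoothFn n) : Sph n → ℂ) x = c • inChart (f : Sph n → ℂ) x := rfl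
    have hd := contDiff_inChart f x
    have h2 : (fun w => fderiv ℝ (inChart ((c • f : SmoothFn n) : Sph n → ℂ) x) w
        (EuclideanSpace.basisFun (Fin n) ℝ i)) = c • fun w =>
        fderiv ℝ (inChart (f : Sph n → ℂ) x) w (EuclideanSpace.basisFun (Fin n) ℝ i) := by
      ext w
      rw [h1, fderiv_const_smul (hd.differentiable (by simp) w)]
      rfl
    rw [h2, fderiv_const_smul]
    · rfl
    · exact ((hd.fderiv_right (m := 1) (by norm_cast)).differentiable (by simp) 0).clm_apply
        (differentiableAt_const _)

theorem sphLap_apply {n : ℕ} (f : SmoothFn n) (x : Sph n) :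
    (sphLap n f : Sph n → ℂ) x = chartLap (f : Sph n → ℂ) x := rfl

theorem sphLap_oneFn (n : ℕ) : sphLap n (oneFn n) = 0 := by
  ext x
  have h : inChart (oneFn n : Sph n → ℂ) x = fun _ => 1 := rfl
  rw [sphLap_apply]
  simp [chartLap, h]

/-- Each derivative lowers the degree of homogeneity by one; degree `-2` is the one required by
`integral_annulusFn_mul`. -/
theorem extLap_smul {n : ℕ} (f : Sph n → ℂ) {t : ℝ} (ht : 0 < t) (y : Amb n) :
    extLap f (t • y) = ((t ^ 2)⁻¹ : ℝ) * extLap f y := by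
  have h0 : (fun z => homExt f (t • z)) = homExt f := funext fun z => homExt_smul f ht z
  have h1 : (fun z => t • fderiv ℝ (homExt f) (t • z)) = fderiv ℝ (homExt f) := by
    ext1 z
    rw [← fderiv_comp_smul, h0]
  have h2 : fderiv ℝ (fderiv ℝ (homExt f)) y = t • t • fderiv ℝ (fderiv ℝ (homExt f)) (t • y) := by
    conv_lhs => rw [← h1]
    change fderiv ℝ (t • fun z => fderiv ℝ (homExt f) (t • z)) y = _
    have := congrFun (fderiv_const_smul_field (𝕜 := ℝ)
      (f := fun z => fderiv ℝ (homExt f) (t • z)) t) y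
    rw [this, Pi.smul_apply, fderiv_comp_smul]
  simp only [extLap_eq_sum f _ (EuclideanSpace.basisFun (Fin (n + 1)) ℝ), h2, Finset.mul_sum]
  refine Finset.sum_congr rfl fun i _ => ?_
  have ht' : (t : ℂ) ≠ 0 := by exact_mod_cast ht.ne'
  simp
  field_simp

/-! ### Symmetry of the sphere Laplacian. -/

/-- A bump function of `‖y‖²` supported in an annulus. -/
def annulusBump : ContDiffBump (2 : ℝ) := ⟨1 / 2, 1, by norm_num, by norm_num⟩

/-- A smooth radial function supported in an annulus. -/
def annulusFn {n : ℕ} (y : Amb n) : ℂ := (annulusBump (‖y‖ ^ 2) : ℂ)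

theorem contDiff_annulusFn {n : ℕ} : ContDiff ℝ ∞ (annulusFn : Amb n → ℂ) :=
  Complex.ofRealCLM.contDiff.comp (annulusBump.contDiff.comp (contDiff_norm_sq ℝ))

theorem annulusFn_eventually_zero {n : ℕ} : ∀ᶠ y : Amb n in 𝓝 0, annulusFn y = 0 := by
  have h : Tendsto (fun y : Amb n => ‖y‖ ^ 2) (𝓝 0) (𝓝 0) := by
    have : Continuous fun y : Amb n => ‖y‖ ^ 2 := by fun_prop
    simpa using this.tendsto 0
  filter_upwards [h.eventually (gt_mem_nhds zero_lt_one)] with y hy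
  rw [annulusFn, annulusBump.zero_of_le_dist, Complex.ofReal_zero]
  rw [Real.dist_eq, abs_sub_comm]
  exact le_trans (by change (1 : ℝ) ≤ _; linarith) (le_abs_self _)

theorem hasCompactSupport_annulusFn {n : ℕ} : HasCompactSupport (annulusFn : Amb n → ℂ) := by
  refine HasCompactSupport.intro (isCompact_closedBall (0 : Amb n) 2) fun y hy => ?_
  rw [mem_closedBall_zero_iff, not_le] at hy
  rw [annulusFn, annulusBump.zero_of_le_dist, Complex.ofReal_zero]
  rw [Real.dist_eq]
  exact le_trans (by change (1 : ℝ) ≤ _; nlinarith) (le_abs_self _)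

theorem contDiff_annulusFn_mul {n : ℕ} {m : ℕ∞ω} (hm : m ≤ ∞) {H : Amb n → ℂ}
    (hH : ∀ y ≠ 0, ContDiffAt ℝ m H y) : ContDiff ℝ m fun y => annulusFn y * H y := by
  rw [contDiff_iff_contDiffAt]
  intro y
  by_cases hy : y = 0
  · refine (contDiffAt_const (c := (0 : ℂ))).congr_of_eventuallyEq ?_
    rw [hy]
    filter_upwards [annulusFn_eventually_zero] with z hz
    rw [hz, zero_mul]
  · exact (contDiff_annulusFn.of_le hm).contDiffAt.mul (hH y hy)

theorem integral_fderiv_eq_zero_of_hasCompactSupport {n : ℕ} {V : Amb n → ℂ}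
    (hV : ContDiff ℝ 1 V) (hc : HasCompactSupport V) (e : Amb n) :
    Integrable (fun y => fderiv ℝ V y e) ∧ ∫ y, fderiv ℝ V y e = 0 := by
  have hi : Integrable fun y => fderiv ℝ V y e :=
    ((hV.continuous_fderiv one_ne_zero).clm_apply continuous_const).integrable_of_hasCompactSupport
      (hc.fderiv_apply ℝ e)
  refine ⟨hi, ?_⟩
  -- Integration by parts against the constant `1`.
  have h := integral_mul_fderiv_eq_neg_fderiv_mul_of_integrable (μ := (volume : Measure (Amb n)))
    (f := fun _ => (1 : ℂ)) (g := V) (v := e) (by simp) (by simpa using hi)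
    (by simpa using hV.continuous.integrable_of_hasCompactSupport hc)
    (fun _ _ => differentiableAt_const _) (fun y _ => hV.differentiable one_ne_zero y)
  simpa using h

/-- The cutoff is radial, so its gradient is a multiple of `y`. The multiple is irrelevant: it is
paired with gradients of functions of degree `0`, which are orthogonal to `y`. -/
theorem fderiv_annulusFn {n : ℕ} (y : Amb n) :
    ∃ c : ℂ, ∀ e, fderiv ℝ annulusFn y e = c * (⟪y, e⟫ : ℝ) := by
  have h1 : HasFDerivAt (fun y : Amb n => ‖y‖ ^ 2) (2 • innerSL ℝ y) y :=
    (hasStrictFDerivAt_norm_sq y).hasFDerivAt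
  have h2 : HasDerivAt (fun s : ℝ => (annulusBump s : ℂ)) _ (‖y‖ ^ 2) :=
    ((annulusBump.contDiff (n := 1)).differentiable one_ne_zero _).hasDerivAt.ofReal_comp
  have h3 : HasFDerivAt (annulusFn : Amb n → ℂ) _ y := 
    HasFDerivAt.comp (g := fun s : ℝ => (annulusBump s : ℂ)) y h2.hasFDerivAt h1
  refine ⟨2 * (deriv annulusBump (‖y‖ ^ 2) : ℝ), fun e => ?_⟩
  rw [h3.fderiv]
  simp
  ring

/-- The polar coordinate formula for products of a radial cutoff with a function homogeneous of
degree `-2`. -/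
theorem integral_annulusFn_mul {n : ℕ} {H : Amb n → ℂ}
    (hH : ∀ (t : ℝ) (x : Sph n), 0 < t → H (t • (x : Amb n)) = ((t ^ 2)⁻¹ : ℝ) * H x) :
    ∫ y, annulusFn y * H y =
      (∫ x : Sph n, H x ∂(volume : Measure (Amb n)).toSphere) *
      ∫ t : Set.Ioi (0 : ℝ), ((annulusBump ((t : ℝ) ^ 2) * ((t : ℝ) ^ 2)⁻¹ : ℝ) : ℂ)
        ∂Measure.volumeIoiPow (Module.finrank ℝ (Amb n) - 1) := by
  have h := (volume : Measure (Amb n)).measurePreserving_homeomorphUnitSphereProd.integral_comp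
    (Homeomorph.measurableEmbedding _) (fun p : Sph n × Set.Ioi (0 : ℝ) =>
      H p.1 * ((annulusBump ((p.2 : ℝ) ^ 2) * ((p.2 : ℝ) ^ 2)⁻¹ : ℝ) : ℂ))
  have h2 := integral_prod_mul (μ := (volume : Measure (Amb n)).toSphere)
    (ν := Measure.volumeIoiPow (Module.finrank ℝ (Amb n) - 1)) (fun x : Sph n => H x)
    (fun t : Set.Ioi (0 : ℝ) => ((annulusBump ((t : ℝ) ^ 2) * ((t : ℝ) ^ 2)⁻¹ : ℝ) : ℂ))
  rw [← h2, ← h]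
  have h3 := integral_subtype_comap (μ := (volume : Measure (Amb n)))
    (measurableSet_singleton (0 : Amb n)).compl (fun y => annulusFn y * H y)
  rw [restrict_compl_singleton] at h3
  rw [← h3]
  refine integral_congr_ae (Eventually.of_forall fun y => ?_)
  have hy : (y : Amb n) ≠ 0 := y.2
  have hpos : 0 < ‖(y : Amb n)‖ := norm_pos_iff.2 hy
  set p := homeomorphUnitSphereProd (Amb n) y with hp
  have hy' : (y : Amb n) = (p.2 : ℝ) • (p.1 : Amb n) := by
    rw [← homeomorphUnitSphereProd_symm_apply_coe, hp, Homeomorph.symm_apply_apply]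
  have ht : ‖(y : Amb n)‖ = (p.2 : ℝ) :=
    (homeomorphUnitSphereProd_apply_snd_coe (Amb n) y).symm
  change annulusFn (y : Amb n) * H y = _
  rw [annulusFn, ht, hy', hH _ _ p.2.2]
  push_cast
  ring

/-- The radial factor of the polar formula does not depend on `H`. It is nonzero: otherwise the
formula for `‖y‖⁻²` would give integral zero to a nonnegative continuous function that is positive
where `‖y‖² = 2`. -/
theorem integral_sphere_eq_zero_of_integral_annulusFn_mul {n : ℕ} {H : Amb n → ℂ}
    (hH : ∀ (t : ℝ) (x : Sph n), 0 < t → H (t • (x : Amb n)) = ((t ^ 2)⁻¹ : ℝ) * H x)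
    (h0 : ∫ y, annulusFn y * H y = 0) :
    ∫ x : Sph n, H x ∂(volume : Measure (Amb n)).toSphere = 0 := by
  rw [integral_annulusFn_mul hH, mul_eq_zero] at h0
  refine h0.resolve_right fun hK => ?_
  have h1 := integral_annulusFn_mul (n := n) (H := fun y => (((‖y‖ ^ 2)⁻¹ : ℝ) : ℂ))
    (fun t x ht => by simp [norm_smul, Real.norm_of_nonneg ht.le])
  rw [hK, mul_zero] at h1
  have hcont : Continuous fun y : Amb n => annulusFn y * (((‖y‖ ^ 2)⁻¹ : ℝ) : ℂ) := by
    refine (contDiff_annulusFn_mul (m := 0) (by simp) fun y hy => ?_).continuous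
    exact Complex.ofRealCLM.contDiff.contDiffAt.comp y
      ((contDiff_norm_sq ℝ).contDiffAt.inv (by positivity))
  set q : Amb n → ℝ := fun y => annulusBump (‖y‖ ^ 2) * (‖y‖ ^ 2)⁻¹ with hq
  have hqc : (fun y : Amb n => annulusFn y * (((‖y‖ ^ 2)⁻¹ : ℝ) : ℂ)) = fun y => (q y : ℂ) := by
    ext y
    simp [annulusFn, hq]
  rw [hqc, integral_complex_ofReal] at h1
  rw [hqc] at hcont
  have hqcont : Continuous q := by
    have := Complex.continuous_re.comp hcont
    simpa [Function.comp_def] using this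
  have hqs : HasCompactSupport q := by
    have h : HasCompactSupport fun y : Amb n => annulusBump (‖y‖ ^ 2) := by
      have := (hasCompactSupport_annulusFn (n := n)).comp_left (g := Complex.re) rfl
      simpa [Function.comp_def, annulusFn] using this
    exact h.mul_right
  have hpos := hqcont.integral_pos_of_hasCompactSupport_nonneg_nonzero
    (μ := (volume : Measure (Amb n))) hqs
    (fun y => mul_nonneg annulusBump.nonneg (by positivity))
    (x := EuclideanSpace.single 0 (Real.sqrt 2)) (by
      have h2 : ‖(EuclideanSpace.single 0 (Real.sqrt 2) : Amb n)‖ ^ 2 = 2 := by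
        simp
      simp only [hq, h2]
      rw [annulusBump.one_of_mem_closedBall (by simp [annulusBump.rIn_pos.le])]
      norm_num)
  exact hpos.ne' (by exact_mod_cast h1)

theorem sum_inner_mul_fderiv_homExt {n : ℕ} (f : SmoothFn n) {y : Amb n} (hy : y ≠ 0) {ι : Type*}
    [Fintype ι] (b : OrthonormalBasis ι ℝ (Amb n)) :
    ∑ i, ((⟪y, b i⟫ : ℝ) : ℂ) * fderiv ℝ (homExt (f : Sph n → ℂ)) y (b i) = 0 := by
  rw [← fderiv_homExt_self f hy]
  conv_rhs => rw [← b.sum_repr' y, map_sum]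
  refine Finset.sum_congr rfl fun i _ => ?_
  rw [map_smul, Complex.real_smul, real_inner_comm, b.sum_repr']

/-- The Laplacian of the sphere is symmetric. -/
theorem integral_sphLap_mul {n : ℕ} (f g : SmoothFn n) :
    ∫ x : Sph n, ((sphLap n f : Sph n → ℂ) x * (g : Sph n → ℂ) x -
      (f : Sph n → ℂ) x * (sphLap n g : Sph n → ℂ) x)
      ∂(volume : Measure (Amb n)).toSphere = 0 := by
  set F := homExt (f : Sph n → ℂ) with hF
  set G := homExt (g : Sph n → ℂ) with hG
  set b := EuclideanSpace.basisFun (Fin (n + 1)) ℝ with hb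
  set H : Amb n → ℂ := fun y => extLap (f : Sph n → ℂ) y * G y - F y * extLap (g : Sph n → ℂ) y
    with hHdef
  have hFd : ∀ y ≠ 0, ContDiffAt ℝ ∞ F y := fun y hy => contDiffAt_homExt f hy
  have hGd : ∀ y ≠ 0, ContDiffAt ℝ ∞ G y := fun y hy => contDiffAt_homExt g hy
  have hHx : ∀ x : Sph n, H x = (sphLap n f : Sph n → ℂ) x * (g : Sph n → ℂ) x -
      (f : Sph n → ℂ) x * (sphLap n g : Sph n → ℂ) x := by
    intro x
    rw [sphLap_apply, sphLap_apply, chartLap_eq_extLap, chartLap_eq_extLap,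
      ← homExt_coe (f : Sph n → ℂ), ← homExt_coe (g : Sph n → ℂ)]
  simp only [← hHx]
  refine integral_sphere_eq_zero_of_integral_annulusFn_mul (fun t x ht => ?_) ?_
  · simp only [hHdef, hF, hG]
    rw [extLap_smul _ ht, extLap_smul _ ht, homExt_smul _ ht, homExt_smul _ ht]
    ring
  -- The flux of Green's second identity. The divergence of `annulusFn * W` is `annulusFn * H`,
  -- because the gradient of the cutoff is radial and `F`, `G` have no radial derivative.
  set W : Amb n → Amb n → ℂ := fun e y => fderiv ℝ F y e * G y - F y * fderiv ℝ G y e with hW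
  have hWd : ∀ e, ∀ y ≠ 0, ContDiffAt ℝ 1 (W e) y := by
    intro e y hy
    have h1 := ((hFd y hy).fderiv_right (m := 1) (by norm_cast)).clm_apply
      (contDiffAt_const (c := e))
    have h2 := ((hGd y hy).fderiv_right (m := 1) (by norm_cast)).clm_apply
      (contDiffAt_const (c := e))
    exact (h1.mul ((hGd y hy).of_le (by norm_cast))).sub
      (((hFd y hy).of_le (by norm_cast)).mul h2)
  have hV := fun e => integral_fderiv_eq_zero_of_hasCompactSupport
    (contDiff_annulusFn_mul (m := 1) (by norm_cast) (hWd e))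
    (hasCompactSupport_annulusFn.mul_right) e
  have hsum : ∀ y, annulusFn y * H y =
      ∑ i, fderiv ℝ (fun y => annulusFn y * W (b i) y) y (b i) := by
    intro y
    by_cases hy : y = 0
    · rw [hy]
      have hz : ∀ i, (fun y => annulusFn y * W (b i) y) =ᶠ[𝓝 0] fun _ => (0 : ℂ) := by
        intro i
        filter_upwards [annulusFn_eventually_zero] with z hz
        rw [hz, zero_mul]
      simp [(hz _).fderiv_eq, annulusFn_eventually_zero.self_of_nhds]
    · obtain ⟨c, hc⟩ := fderiv_annulusFn y
      have hterm : ∀ i, fderiv ℝ (fun y => annulusFn y * W (b i) y) y (b i) =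
          c * G y * ((⟪y, b i⟫ : ℝ) * fderiv ℝ F y (b i)) -
          c * F y * ((⟪y, b i⟫ : ℝ) * fderiv ℝ G y (b i)) +
          annulusFn y * (fderiv ℝ (fderiv ℝ F) y (b i) (b i) * G y -
            F y * fderiv ℝ (fderiv ℝ G) y (b i) (b i)) := by
        intro i
        have hF1 := ((hFd y hy).differentiableAt (by simp)).hasFDerivAt
        have hG1 := ((hGd y hy).differentiableAt (by simp)).hasFDerivAt
        have hF2 := (differentiableAt_fderiv_homExt f hy).hasFDerivAt.clm_apply
          (hasFDerivAt_const (b i) y)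
        have hG2 := (differentiableAt_fderiv_homExt g hy).hasFDerivAt.clm_apply
          (hasFDerivAt_const (b i) y)
        have hA := ((contDiff_annulusFn (n := n)).differentiable (by simp) y).hasFDerivAt
        have hW1 : HasFDerivAt (W (b i)) _ y := (hF2.mul hG1).sub (hF1.mul hG2)
        rw [(hA.fun_mul hW1).fderiv]
        simp [hc, hW]
        ring
      simp only [hterm, Finset.sum_add_distrib, Finset.sum_sub_distrib, ← Finset.mul_sum,
        ← Finset.sum_mul]
      rw [sum_inner_mul_fderiv_homExt f hy, sum_inner_mul_fderiv_homExt g hy, ← extLap_eq_sum,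
        ← extLap_eq_sum]
      simp [hHdef]
  simp only [hsum]
  rw [integral_finsetSum _ fun i _ => (hV (b i)).1]
  exact Finset.sum_eq_zero fun i _ => (hV (b i)).2

/-! ### Formal solutions as a recursion for the coefficients. -/

-- Vanishing of the limit at `0` removes the constant coefficient; dividing by `X` then lowers both
-- the polynomial and the order `d`.
open Polynomial in
theorem isBigO_eval_pow_iff (Q : ℂ[X]) (d : ℕ) :
    (fun r : ℝ => Q.eval (r : ℂ)) =O[𝓝[>] 0] (fun r : ℝ => r ^ d) ↔ ∀ k < d, Q.coeff k = 0 := by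
  have hcont : ∀ R : ℂ[X], Tendsto (fun r : ℝ => R.eval (r : ℂ)) (𝓝[>] 0) (𝓝 (R.coeff 0)) := by
    intro R
    have : Continuous fun r : ℝ => R.eval (r : ℂ) := R.continuous.comp Complex.continuous_ofReal
    have h := this.tendsto 0
    rw [Complex.ofReal_zero, ← coeff_zero_eq_eval_zero] at h
    exact h.mono_left nhdsWithin_le_nhds
  constructor
  · induction d generalizing Q with
    | zero => simp
    | succ d ih =>
      intro h
      have h0 : Q.coeff 0 = 0 := by
        refine tendsto_nhds_unique (hcont Q) (h.trans_tendsto ?_)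
        have : Tendsto (fun r : ℝ => r ^ (d + 1)) (𝓝 0) (𝓝 0) := by
          simpa using (continuous_pow (d + 1)).tendsto (0 : ℝ)
        exact this.mono_left nhdsWithin_le_nhds
      have hQ : ∀ z, Q.eval z = Q.divX.eval z * z := by
        intro z
        conv_lhs => rw [← Q.divX_mul_X_add, h0]
        simp
      have h1 : (fun r : ℝ => Q.divX.eval (r : ℂ)) =O[𝓝[>] 0] (fun r : ℝ => r ^ d) := by
        have hinv : (fun r : ℝ => (r : ℂ)⁻¹) =O[𝓝[>] 0] fun r : ℝ => r⁻¹ :=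
          IsBigO.of_bound 1 (Eventually.of_forall fun r => by simp)
        refine (h.mul hinv).congr' ?_ ?_
        · filter_upwards [self_mem_nhdsWithin] with r hr
          have : (r : ℂ) ≠ 0 := by exact_mod_cast (ne_of_gt hr)
          rw [hQ]
          field_simp
        · filter_upwards [self_mem_nhdsWithin] with r hr
          have : r ≠ 0 := ne_of_gt hr
          field_simp
          ring
      intro k hk
      rcases k with _ | k
      · exact h0
      · rw [← coeff_divX]
        exact ih _ h1 k (by omega)
  · intro h
    obtain ⟨R, rfl⟩ := X_pow_dvd_iff.2 h
    have h1 : (fun r : ℝ => (r : ℂ) ^ d) =O[𝓝[>] 0] fun r : ℝ => r ^ d :=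
      IsBigO.of_bound 1 (Eventually.of_forall fun r => by simp)
    simpa using h1.mul ((hcont R).isBigO_one ℝ)

/-- The coefficient of `r^(lam + d)` in `(1 - r²/4)² (Δ u + lam (n - lam) u)`, where
`u = ∑ r^(lam + k) a_k`. -/
def residualCoeff (n : ℕ) (lam : ℂ) (a : ℕ → SmoothFn n) (d : ℕ) : SmoothFn n :=
  (d * (2 * lam + d - n) : ℂ) • a d +
  (if 2 ≤ d then sphLap n (a (d - 2)) - ((d - 2 : ℕ) * (2 * lam + (d - 2 : ℕ) - n) / 2
    + n / 2 * (lam + (d - 2 : ℕ)) : ℂ) • a (d - 2) else 0) +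
  (if 4 ≤ d then ((d - 4 : ℕ) * (2 * lam + (d - 4 : ℕ) - n) / 16
    + n / 8 * (lam + (d - 4 : ℕ)) : ℂ) • a (d - 4) else 0)

/-- With `s = lam + k`, the indicial polynomial `s (s - 1) + (1 - n) s + lam (n - lam)` equals `k (2
lam + k - n)`. Factoring out `(1 - r²/4)⁻²` leaves only the shifts `0`, `2`, `4` in the exponent. -/
theorem lapPE_expansion (n : ℕ) (lam : ℂ) (m : ℕ) (a : ℕ → SmoothFn n) (x : Sph n) {r : ℝ}
    (h0 : 0 < r) (h2 : r < 2) :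
    lapPE n (expansion n lam m a) (x, r) + lam * (n - lam) * expansion n lam m a (x, r) =
      ((r : ℂ) ^ lam * ((1 - (r : ℂ) ^ 2 / 4) ^ 2)⁻¹) * ∑ k ∈ Finset.range (m + 1),
        (k * (2 * lam + k - n) * (a k : Sph n → ℂ) x * r ^ k
        + ((sphLap n (a k) : Sph n → ℂ) x - (k * (2 * lam + k - n) / 2 + n / 2 * (lam + k)) *
          (a k : Sph n → ℂ) x) * r ^ (k + 2)
        + (k * (2 * lam + k - n) / 16 + n / 8 * (lam + k)) * (a k : Sph n → ℂ) x * r ^ (k + 4)) := by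
  have hd : ∀ (c : ℂ) (s : ℝ), 0 < s →
      HasDerivAt (fun s : ℝ => (s : ℂ) ^ c) (c * (s : ℂ) ^ (c - 1)) s := by
    intro c s hs
    have h := ((hasDerivAt_id (s : ℂ)).cpow_const (c := c)
      (Complex.ofReal_mem_slitPlane.2 hs)).comp_ofReal
    simpa using h
  have hlap := lapPE_sum_separated (Finset.range (m + 1))
    (g := fun k s => (s : ℂ) ^ (lam + k)) (g' := fun k s => (lam + k) * (s : ℂ) ^ (lam + k - 1))
    (g'' := fun k s => (lam + k) * ((lam + k - 1) * (s : ℂ) ^ (lam + k - 1 - 1))) a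
    (fun k _ s hs => hd _ s hs) (fun k _ s hs => (hd _ s hs).const_mul _) x h0 h2
  have hr : (r : ℂ) ≠ 0 := by exact_mod_cast h0.ne'
  have hρ : (4 - (r : ℂ) ^ 2) ≠ 0 := by
    have : (4 : ℝ) - r ^ 2 ≠ 0 := by nlinarith
    exact_mod_cast this
  have hρ' : (1 - (r : ℂ) ^ 2 / 4) ≠ 0 := by
    intro h; apply hρ; linear_combination 4 * h
  rw [show lapPE n (expansion n lam m a) (x, r) = _ from hlap, expansion, Finset.mul_sum,
    Finset.mul_sum, ← Finset.sum_add_distrib]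
  refine Finset.sum_congr rfl fun k _ => ?_
  rw [sphLap_apply]
  simp only [Complex.cpow_sub _ _ hr, Complex.cpow_add _ _ hr, Complex.cpow_one,
    Complex.cpow_natCast]
  field_simp
  ring

/-- The prefactor `r^lam (1 - r²/4)⁻²` has exact order `r^(Re lam)` and can be divided out, leaving
a polynomial that must be `O(r^(m + 1))`. -/
theorem isFormalSolution_iff (n : ℕ) (lam : ℂ) (m : ℕ) (a : ℕ → SmoothFn n) :
    IsFormalSolution n lam m a ↔ ∀ d ≤ m, residualCoeff n lam a d = 0 := by
  have hx : ∀ x : Sph n,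
      ((fun r : ℝ => lapPE n (expansion n lam m a) (x, r)
        + lam * (n - lam) * expansion n lam m a (x, r))
      =O[𝓝[>] 0] fun r : ℝ => r ^ (lam.re + m + 1)) ↔
      ∀ d < m + 1, (residualCoeff n lam a d : Sph n → ℂ) x = 0 := by
    intro x
    set Q : Polynomial ℂ := ∑ k ∈ Finset.range (m + 1),
      (Polynomial.C (k * (2 * lam + k - n) * (a k : Sph n → ℂ) x) * Polynomial.X ^ k
      + Polynomial.C ((sphLap n (a k) : Sph n → ℂ) x - (k * (2 * lam + k - n) / 2
        + n / 2 * (lam + k)) * (a k : Sph n → ℂ) x) * Polynomial.X ^ (k + 2)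
      + Polynomial.C ((k * (2 * lam + k - n) / 16 + n / 8 * (lam + k)) * (a k : Sph n → ℂ) x) *
        Polynomial.X ^ (k + 4)) with hQ
    -- Cutting the sum at `k = m` does not affect these coefficients: they involve only indices at
    -- most `d ≤ m`.
    have hcoeff : ∀ d < m + 1, Q.coeff d = (residualCoeff n lam a d : Sph n → ℂ) x := by
      intro d hd
      have hs : ∀ (c : ℕ → ℂ) (j : ℕ), ∑ k ∈ Finset.range (m + 1),
          (Polynomial.C (c k) * Polynomial.X ^ (k + j)).coeff d =
          if j ≤ d then c (d - j) else 0 := by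
        intro c j
        simp only [Polynomial.coeff_C_mul_X_pow]
        split_ifs with hj
        · rw [Finset.sum_eq_single (d - j)]
          · rw [if_pos (by omega)]
          · intro b _ hb
            rw [if_neg (by omega)]
          · intro h
            exact absurd (Finset.mem_range.2 (by omega)) h
        · exact Finset.sum_eq_zero fun k _ => if_neg (by omega)
      have hs0 := hs (fun k => k * (2 * lam + k - n) * (a k : Sph n → ℂ) x) 0
      simp only [add_zero, Nat.sub_zero, Nat.zero_le, if_true] at hs0
      rw [hQ, Polynomial.finsetSum_coeff]
      simp only [Polynomial.coeff_add, Finset.sum_add_distrib]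
      rw [hs0, hs (fun k => (sphLap n (a k) : Sph n → ℂ) x - (k * (2 * lam + k - n) / 2
        + n / 2 * (lam + k)) * (a k : Sph n → ℂ) x) 2, hs (fun k => (k * (2 * lam + k - n) / 16
        + n / 8 * (lam + k)) * (a k : Sph n → ℂ) x) 4]
      simp only [residualCoeff]
      split_ifs <;> simp
    set w : ℝ → ℂ := fun r => (r : ℂ) ^ lam * ((1 - (r : ℂ) ^ 2 / 4) ^ 2)⁻¹ with hw
    have hE : (fun r : ℝ => lapPE n (expansion n lam m a) (x, r)
        + lam * (n - lam) * expansion n lam m a (x, r)) =ᶠ[𝓝[>] 0]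
        fun r => w r * Q.eval (r : ℂ) := by
      filter_upwards [Ioo_mem_nhdsGT (zero_lt_two (α := ℝ))] with r hr
      rw [lapPE_expansion n lam m a x hr.1 hr.2, hQ, Polynomial.eval_finsetSum]
      simp [hw]
    have hwΘ : w =Θ[𝓝[>] 0] fun r : ℝ => r ^ lam.re := by
      have hn : ∀ r ∈ Set.Ioo (0 : ℝ) 1, ‖w r‖ = r ^ lam.re * ((1 - r ^ 2 / 4) ^ 2)⁻¹ ∧
          1 / 2 ≤ (1 - r ^ 2 / 4) ^ 2 ∧ (1 - r ^ 2 / 4) ^ 2 ≤ 1 := by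
        intro r hr
        have h1 : (1 - (r : ℂ) ^ 2 / 4) = ((1 - r ^ 2 / 4 : ℝ) : ℂ) := by push_cast; rfl
        have h2 : 0 < r ^ 2 := pow_pos hr.1 2
        have h3 : r ^ 2 < 1 := by nlinarith [hr.1, hr.2]
        refine ⟨?_, by nlinarith, by nlinarith⟩
        rw [hw]
        simp only [norm_mul, norm_inv, norm_pow, h1, Complex.norm_real,
          Complex.norm_cpow_eq_rpow_re_of_pos hr.1, Real.norm_eq_abs, sq_abs]
      refine ⟨IsBigO.of_bound 2 ?_, IsBigO.of_bound 1 ?_⟩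
      · filter_upwards [Ioo_mem_nhdsGT (zero_lt_one (α := ℝ))] with r hr
        obtain ⟨h1, h2, h3⟩ := hn r hr
        have hp : 0 ≤ r ^ lam.re := Real.rpow_nonneg hr.1.le _
        rw [h1, Real.norm_of_nonneg hp, mul_comm]
        gcongr
        rw [inv_le_comm₀ (by linarith) (by norm_num)]
        linarith
      · filter_upwards [Ioo_mem_nhdsGT (zero_lt_one (α := ℝ))] with r hr
        obtain ⟨h1, h2, h3⟩ := hn r hr
        have hp : 0 ≤ r ^ lam.re := Real.rpow_nonneg hr.1.le _
        rw [h1, Real.norm_of_nonneg hp, one_mul]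
        exact le_mul_of_one_le_right hp ((one_le_inv₀ (by linarith)).2 h3)
    have hpow : (fun r : ℝ => r ^ (lam.re + m + 1)) =ᶠ[𝓝[>] 0]
        fun r => r ^ lam.re * r ^ (m + 1) := by
      filter_upwards [self_mem_nhdsWithin] with r hr
      rw [add_assoc, Real.rpow_add hr, ← Nat.cast_add_one, Real.rpow_natCast]
    rw [isBigO_congr hE hpow]
    have hiff : ((fun r => w r * Q.eval (r : ℂ)) =O[𝓝[>] 0]
        fun r : ℝ => r ^ lam.re * r ^ (m + 1)) ↔
        (fun r : ℝ => Q.eval (r : ℂ)) =O[𝓝[>] 0] fun r : ℝ => r ^ (m + 1) := by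
      refine ⟨fun h => ?_, fun h => hwΘ.1.mul h⟩
      refine (hwΘ.inv.1.mul h).congr' ?_ ?_
      · filter_upwards [Ioo_mem_nhdsGT (zero_lt_two (α := ℝ))] with r hr
        have h1 : (r : ℂ) ≠ 0 := by exact_mod_cast hr.1.ne'
        have h2 : (1 - (r : ℂ) ^ 2 / 4) ≠ 0 := by
          have : 1 - r ^ 2 / 4 ≠ 0 := by nlinarith [hr.1, hr.2]
          exact_mod_cast this
        have h3 : w r ≠ 0 := by
          refine mul_ne_zero ?_ (inv_ne_zero (pow_ne_zero _ h2))
          rw [Complex.cpow_def_of_ne_zero h1]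
          exact Complex.exp_ne_zero _
        rw [inv_mul_cancel_left₀ h3]
      · filter_upwards [self_mem_nhdsWithin] with r hr
        rw [inv_mul_cancel_left₀ (Real.rpow_pos_of_pos hr _).ne']
    rw [hiff, isBigO_eval_pow_iff]
    exact forall₂_congr fun d hd => by rw [hcoeff d hd]
  unfold IsFormalSolution
  simp only [hx]
  constructor
  · intro h d hd
    ext x
    exact h x d (by omega)
  · intro h x d hd
    rw [h d (by omega)]
    rfl

/-! ### Solving the recursion; the solution operators. -/

/-- The indicial factor `4 j (n/2 - lam - j)`. -/
def indicial (n : ℕ) (lam : ℂ) (j : ℕ) : ℂ := 4 * j * ((n : ℂ) / 2 - lam - j)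

/-- The operators `P_{2j}(lam)`, defined by a three-term recursion. -/
def poissonOp (n : ℕ) (lam : ℂ) : ℕ → SmoothOp n
  | 0 => LinearMap.id
  | 1 => sphLap n - ((n : ℂ) / 2 * lam) • LinearMap.id
  | j + 2 => sphLap n ∘ₗ poissonOp n lam (j + 1)
      - (2 * (j + 1) * (lam + (j + 1)) + n / 2 * lam : ℂ) • poissonOp n lam (j + 1)
      + (indicial n lam (j + 1) * ((n / 2 + j) * (lam + j)) / 4 : ℂ) • poissonOp n lam j

theorem normFactor_zero (n : ℕ) (lam : ℂ) : normFactor n 0 lam = 1 := by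
  simp [normFactor]

theorem normFactor_succ (n j : ℕ) (lam : ℂ) :
    normFactor n (j + 1) lam = normFactor n j lam * indicial n lam (j + 1) := by
  rw [normFactor, normFactor, Finset.prod_Icc_succ_top (by omega), Nat.factorial_succ, indicial]
  push_cast
  ring

theorem normFactor_ne_zero {n N : ℕ} {lam : ℂ} (h : IsRegularParameter n N lam) {j : ℕ}
    (hj : j ≤ N) : normFactor n j lam ≠ 0 := by
  rw [normFactor]
  refine mul_ne_zero (mul_ne_zero (pow_ne_zero _ two_ne_zero)
    (by exact_mod_cast j.factorial_ne_zero)) ?_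
  refine Finset.prod_ne_zero_iff.2 fun i hi h0 => ?_
  rw [Finset.mem_Icc] at hi
  refine h i (Finset.mem_Icc.2 ⟨hi.1, hi.2.trans hj⟩) ?_
  linear_combination -h0

theorem residualCoeff_two (n : ℕ) (lam : ℂ) (a : ℕ → SmoothFn n) :
    residualCoeff n lam a 2 = sphLap n (a 0) - ((n : ℂ) / 2 * lam) • a 0
      - indicial n lam 1 • a 2 := by
  simp only [residualCoeff, indicial]
  norm_num
  match_scalars
  · ring
  · ring
  · ring

/-- The contributions to the coefficient of `a (2 * j)` combine into the product `(n/2 + j) (lam +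
j) / 4`, the source of the Pochhammer factors. -/
theorem residualCoeff_even (n : ℕ) (lam : ℂ) (a : ℕ → SmoothFn n) (j : ℕ) :
    residualCoeff n lam a (2 * (j + 2)) = sphLap n (a (2 * (j + 1)))
      - (2 * (j + 1) * (lam + (j + 1)) + n / 2 * lam : ℂ) • a (2 * (j + 1))
      + ((n / 2 + j) * (lam + j) / 4 : ℂ) • a (2 * j) - indicial n lam (j + 2) • a (2 * (j + 2)) := by
  rw [residualCoeff, if_pos (by omega), if_pos (by omega), show 2 * (j + 2) - 2 = 2 * (j + 1) by omega,
    show 2 * (j + 2) - 4 = 2 * j by omega, indicial]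
  push_cast
  match_scalars
  · ring
  · ring
  · ring
  · ring

/-- Multiply the recursion by `normFactor n (j + 1) lam`: the term in `a (2 * j)` keeps a factor
`indicial n lam (j + 1)`, which explains its presence in `poissonOp`. Nothing is divided, so this
holds at the poles too. -/
theorem normFactor_smul_eq {n N : ℕ} {lam : ℂ} {a : ℕ → SmoothFn n}
    (h : ∀ j, j ≤ N → residualCoeff n lam a (2 * j) = 0) :
    ∀ j, j ≤ N → normFactor n j lam • a (2 * j) = poissonOp n lam j (a 0)
  | 0, _ => by simp [normFactor_zero, poissonOp]
  | 1, h1 => by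
    have h2 := h 1 h1
    rw [mul_one, residualCoeff_two, sub_eq_zero] at h2
    rw [normFactor_succ, normFactor_zero, one_mul, mul_one, zero_add, ← h2]
    rfl
  | j + 2, hj => by
    have h2 := h (j + 2) hj
    rw [residualCoeff_even, sub_eq_zero] at h2
    rw [normFactor_succ, mul_smul, ← h2, poissonOp]
    have e1 := normFactor_smul_eq h (j + 1) (by omega)
    have e0 := normFactor_smul_eq h j (by omega)
    simp only [LinearMap.add_apply, LinearMap.sub_apply, LinearMap.smul_apply,
      LinearMap.comp_apply, ← e1, ← e0, map_smul, normFactor_succ]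
    module

/-- The recursion preserves parity, so the odd coefficients may be taken zero. They need not be
unique, since an odd indicial factor `d (2 lam + d - n)` can vanish at a regular `lam`, but they do
not influence `a (2 * N)`. -/
theorem exists_formalSolution {n N : ℕ} {lam : ℂ} (hlam : IsRegularParameter n N lam)
    (f : SmoothFn n) : ∃ a : ℕ → SmoothFn n, a 0 = f ∧ IsFormalSolution n lam (2 * N) a := by
  -- Beyond `2 * N` the factor may vanish and its inverse is then `0`; those coefficients never
  -- enter.
  let a : ℕ → SmoothFn n := fun k =>
    if Even k then (normFactor n (k / 2) lam)⁻¹ • poissonOp n lam (k / 2) f else 0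
  have ha : ∀ j, a (2 * j) = (normFactor n j lam)⁻¹ • poissonOp n lam j f := by
    intro j
    simp [a]
  have ha0 : a 0 = f := by simpa [normFactor_zero, poissonOp] using ha 0
  refine ⟨a, ha0, (isFormalSolution_iff n lam _ a).2 fun d hd => ?_⟩
  rcases Nat.even_or_odd' d with ⟨j, rfl | rfl⟩
  · have hj : j ≤ N := by omega
    rcases j with _ | _ | j
    · simp [residualCoeff]
    · have hn := normFactor_ne_zero hlam hj
      have h1 := ha 1
      rw [zero_add, normFactor_succ, normFactor_zero, zero_add, one_mul] at hn
      rw [normFactor_succ, normFactor_zero, zero_add, one_mul, mul_one] at h1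
      rw [zero_add, mul_one, residualCoeff_two, h1, ha0, smul_smul, mul_inv_cancel₀ hn, one_smul,
        sub_eq_zero]
      rfl
    · have n0 := normFactor_ne_zero hlam (show j ≤ N by omega)
      have n2 := normFactor_ne_zero hlam hj
      rw [normFactor_succ, normFactor_succ] at n2
      have i1 := (mul_ne_zero_iff.1 (mul_ne_zero_iff.1 n2).1).2
      have i2 := (mul_ne_zero_iff.1 n2).2
      rw [residualCoeff_even, ha, ha, ha, poissonOp, normFactor_succ n (j + 1), normFactor_succ]
      simp only [LinearMap.add_apply, LinearMap.sub_apply, LinearMap.smul_apply,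
        LinearMap.comp_apply, map_smul]
      match_scalars
      · field_simp
        ring
      · field_simp
        ring
      · field_simp
        ring
  · have hodd : ∀ i, ¬ Even i → a i = 0 := fun i hi => if_neg hi
    have h1 : a (2 * j + 1) = 0 := hodd _ (by simp)
    rw [residualCoeff, h1, smul_zero, zero_add]
    have h2 : 2 ≤ 2 * j + 1 → a (2 * j + 1 - 2) = 0 := fun h =>
      hodd _ (by rw [Nat.even_sub h]; simp)
    have h4 : 4 ≤ 2 * j + 1 → a (2 * j + 1 - 4) = 0 := fun h =>
      hodd _ (by rw [Nat.even_sub h]; simp [show Even 4 by decide])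
    split_ifs with c2 c4 c4
    · rw [h2 c2, h4 c4]; simp
    · rw [h2 c2]; simp
    · omega
    · simp

theorem isSolutionOperator_iff {n N : ℕ} {lam : ℂ} (hlam : IsRegularParameter n N lam)
    (A : SmoothOp n) :
    IsSolutionOperator n N lam A ↔ A = (normFactor n N lam)⁻¹ • poissonOp n lam N := by
  have hne := normFactor_ne_zero hlam le_rfl
  have key : ∀ (f : SmoothFn n) (a : ℕ → SmoothFn n), a 0 = f → IsFormalSolution n lam (2 * N) a →
      a (2 * N) = ((normFactor n N lam)⁻¹ • poissonOp n lam N) f := by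
    intro f a ha0 ha
    have h := normFactor_smul_eq (N := N)
      (fun j hj => (isFormalSolution_iff n lam _ a).1 ha (2 * j) (by omega)) N le_rfl
    rw [LinearMap.smul_apply, ← ha0, ← h, smul_smul, inv_mul_cancel₀ hne, one_smul]
  constructor
  · intro h
    ext1 f
    obtain ⟨a, ha0, ha⟩ := (h f).1
    rw [← (h f).2 a ha0 ha, key f a ha0 ha]
  · rintro rfl f
    exact ⟨exists_formalSolution hlam f, key f⟩

/-- As `Δ 1 = 0`, the recursion is scalar. With `J = j + 1` it reduces to `(n/2 + J) (lam + J) = 2 J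
(lam + J) + n lam / 2 + J (n/2 - lam - J)`. -/
theorem poissonOp_oneFn (n : ℕ) (lam : ℂ) (j : ℕ) :
    poissonOp n lam j (oneFn n) = ((-1) ^ j * poch ((n : ℂ) / 2) j * poch lam j) • oneFn n := by
  induction j using Nat.twoStepInduction with
  | zero => simp [poissonOp, poch]
  | one =>
    simp only [poissonOp, LinearMap.sub_apply, LinearMap.smul_apply, LinearMap.id_apply,
      sphLap_oneFn, poch, Finset.prod_range_one]
    module
  | more j h0 h1 =>
    simp only [poissonOp, LinearMap.add_apply, LinearMap.sub_apply, LinearMap.smul_apply,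
      LinearMap.comp_apply, h0, h1, map_smul, sphLap_oneFn, smul_zero, indicial]
    simp only [poch, Finset.prod_range_succ]
    match_scalars
    ring

/-! ### Polynomial dependence on `lam` and uniqueness of the family. -/

/-- Polynomials over the endomorphism ring, evaluated at the central element `lam`, are closed under
sums, left multiplication by `Δ` and multiplication by scalar polynomials (`hC`), so no degrees have
to be tracked. -/
theorem exists_polynomial_poissonOp (n j : ℕ) :
    ∃ p : Polynomial (Module.End ℂ (SmoothFn n)),
      ∀ lam : ℂ, poissonOp n lam j = p.eval (algebraMap ℂ _ lam) := by
  have hC : ∀ q : Polynomial ℂ, ∀ p : Polynomial (Module.End ℂ (SmoothFn n)),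
      ∃ p' : Polynomial (Module.End ℂ (SmoothFn n)), ∀ lam : ℂ,
        p'.eval (algebraMap ℂ _ lam) = q.eval lam • p.eval (algebraMap ℂ _ lam) := by
    intro q p
    induction q using Polynomial.induction_on with
    | C c => exact ⟨c • p, fun lam => by simp [Polynomial.eval_smul]⟩
    | add q r hq hr =>
      obtain ⟨p1, h1⟩ := hq
      obtain ⟨p2, h2⟩ := hr
      exact ⟨p1 + p2, fun lam => by rw [Polynomial.eval_add, h1, h2, Polynomial.eval_add, add_smul]⟩
    | monomial k c h =>
      obtain ⟨p1, h1⟩ := h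
      refine ⟨p1 * Polynomial.X, fun lam => ?_⟩
      rw [Polynomial.eval_mul_X, h1, ← Algebra.commutes, ← Algebra.smul_def, smul_smul]
      congr 1
      simp
      ring
  let L : Module.End ℂ (SmoothFn n) := sphLap n
  induction j using Nat.twoStepInduction with
  | zero => exact ⟨1, fun lam => by simp [poissonOp]; rfl⟩
  | one =>
    obtain ⟨p, hp⟩ := hC (-(Polynomial.C ((n : ℂ) / 2) * Polynomial.X)) 1
    refine ⟨Polynomial.C L + p, fun lam => ?_⟩
    rw [Polynomial.eval_add, hp, poissonOp, Polynomial.eval_C, Polynomial.eval_one]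
    ext1 f
    change sphLap n f - ((n : ℂ) / 2 * lam) • f = sphLap n f + Polynomial.eval lam _ • f
    simp only [Polynomial.eval_neg, Polynomial.eval_mul, Polynomial.eval_C, Polynomial.eval_X]
    module
  | more j h0 h1 =>
    obtain ⟨p0, h0⟩ := h0
    obtain ⟨p1, h1⟩ := h1
    obtain ⟨q1, e1⟩ := hC (-(2 * (Polynomial.C (j : ℂ) + 1) *
      (Polynomial.X + (Polynomial.C (j : ℂ) + 1)) + Polynomial.C ((n : ℂ) / 2) * Polynomial.X)) p1
    obtain ⟨q0, e0⟩ := hC (Polynomial.C (4 * ((j : ℂ) + 1)) *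
      (Polynomial.C ((n : ℂ) / 2) - Polynomial.X - Polynomial.C ((j : ℂ) + 1)) *
      (Polynomial.C ((n : ℂ) / 2 + j) * (Polynomial.X + Polynomial.C (j : ℂ))) *
      Polynomial.C (1 / 4)) p0
    refine ⟨Polynomial.C L * p1 + q1 + q0, fun lam => ?_⟩
    rw [Polynomial.eval_add, Polynomial.eval_add, Polynomial.eval_C_mul, e1, e0, poissonOp, ← h0,
      ← h1, Polynomial.eval_neg]
    congr 2
    · ext1 f
      change sphLap n (poissonOp n lam (j + 1) f) - (_ : ℂ) • poissonOp n lam (j + 1) f =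
        sphLap n (poissonOp n lam (j + 1) f) + (-Polynomial.eval lam _) •
          poissonOp n lam (j + 1) f
      simp
      module
    · simp [indicial]
      ring

theorem poissonOp_eq_sum (n j : ℕ) : ∃ (d : ℕ) (C : ℕ → SmoothOp n), ∀ lam : ℂ,
    poissonOp n lam j = ∑ k ∈ Finset.range (d + 1), lam ^ k • C k := by
  obtain ⟨p, hp⟩ := exists_polynomial_poissonOp n j
  refine ⟨p.natDegree, fun k => p.coeff k, fun lam => ?_⟩
  rw [hp, Polynomial.eval_eq_sum_range]
  refine Finset.sum_congr rfl fun k _ => ?_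
  rw [← map_pow, ← Algebra.commutes, ← Algebra.smul_def]

theorem infinite_isRegularParameter (n N : ℕ) : {lam | IsRegularParameter n N lam}.Infinite := by
  have hfin : ((fun j : ℕ => (n : ℂ) / 2 - j) '' (Finset.Icc 1 N : Set ℕ)).Finite :=
    (Finset.finite_toSet _).image _
  refine hfin.infinite_compl.mono fun lam hlam => ?_
  intro j hj h
  exact hlam ⟨j, hj, h.symm⟩

/-- Evaluated at a fixed `f` and `x`, both families become complex polynomials in `lam` that agree
at the infinitely many regular parameters, hence everywhere. -/
theorem isPFamily_iff {n N : ℕ} (P : ℂ → SmoothOp n) :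
    IsPFamily n N P ↔ P = fun lam => poissonOp n lam N := by
  constructor
  · rintro ⟨⟨d, C, hP⟩, hT⟩
    obtain ⟨d', C', hP'⟩ := poissonOp_eq_sum n N
    have hreg : ∀ lam, IsRegularParameter n N lam → P lam = poissonOp n lam N := by
      intro lam hlam
      have h := (isSolutionOperator_iff hlam _).1 (hT lam hlam)
      exact smul_right_injective _ (inv_ne_zero (normFactor_ne_zero hlam le_rfl)) h
    ext lam f x
    let q : (ℕ → SmoothOp n) → ℕ → Polynomial ℂ := fun C d =>
      ∑ k ∈ Finset.range (d + 1), Polynomial.C ((C k f : Sph n → ℂ) x) * Polynomial.X ^ k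
    have hq : ∀ (C : ℕ → SmoothOp n) (d : ℕ) (lam : ℂ), (q C d).eval lam =
        (((∑ k ∈ Finset.range (d + 1), lam ^ k • C k) f : SmoothFn n) : Sph n → ℂ) x := by
      intro C d lam
      simp only [q, Polynomial.eval_finsetSum, Polynomial.eval_mul, Polynomial.eval_C,
        Polynomial.eval_pow, Polynomial.eval_X, LinearMap.sum_apply, LinearMap.smul_apply,
        Submodule.coe_sum, Finset.sum_apply, Submodule.coe_smul, Pi.smul_apply, smul_eq_mul]
      exact Finset.sum_congr rfl fun k _ => mul_comm _ _
    have heq : q C d = q C' d' := by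
      refine Polynomial.eq_of_infinite_eval_eq _ _
        ((infinite_isRegularParameter n N).mono fun lam hlam => ?_)
      change (q C d).eval lam = (q C' d').eval lam
      rw [hq, hq, ← hP, ← hP', hreg lam hlam]
    rw [hP, hP', ← hq, ← hq, heq]
  · rintro rfl
    exact ⟨poissonOp_eq_sum n N, fun lam hlam => (isSolutionOperator_iff hlam _).2 rfl⟩

/-! ### Formal adjoints. -/

theorem continuous_smoothFn {n : ℕ} (f : SmoothFn n) : Continuous (f : Sph n → ℂ) :=
  ContMDiff.continuous f.2

theorem integrable_smoothFn_mul {n : ℕ} (f g : SmoothFn n) :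
    Integrable (fun x => (f : Sph n → ℂ) x * (g : Sph n → ℂ) x)
      (volume : Measure (Amb n)).toSphere :=
  ((continuous_smoothFn f).mul (continuous_smoothFn g)).integrable_of_hasCompactSupport
    (HasCompactSupport.of_compactSpace _)

theorem isFormalAdjoint_id (n : ℕ) : IsFormalAdjoint (LinearMap.id : SmoothOp n) LinearMap.id :=
  fun _ _ => rfl

theorem isFormalAdjoint_sphLap (n : ℕ) : IsFormalAdjoint (sphLap n) (sphLap n) := by
  intro f g
  have h := integral_sphLap_mul f g
  rwa [integral_sub (integrable_smoothFn_mul _ _) (integrable_smoothFn_mul _ _), sub_eq_zero] at h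

theorem IsFormalAdjoint.add {n : ℕ} {A B A' B' : SmoothOp n} (h : IsFormalAdjoint A B)
    (h' : IsFormalAdjoint A' B') : IsFormalAdjoint (A + A') (B + B') := by
  intro f g
  simp only [LinearMap.add_apply, Submodule.coe_add, Pi.add_apply, add_mul, mul_add]
  rw [integral_add (integrable_smoothFn_mul _ _) (integrable_smoothFn_mul _ _),
    integral_add (integrable_smoothFn_mul _ _) (integrable_smoothFn_mul _ _), h, h']

theorem IsFormalAdjoint.smul {n : ℕ} {A B : SmoothOp n} (h : IsFormalAdjoint A B) (c : ℂ) :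
    IsFormalAdjoint (c • A) (c • B) := by
  intro f g
  simp only [LinearMap.smul_apply, Submodule.coe_smul, Pi.smul_apply, smul_eq_mul, mul_assoc,
    mul_left_comm _ c]
  rw [integral_const_mul, integral_const_mul, h]

theorem IsFormalAdjoint.sub {n : ℕ} {A B A' B' : SmoothOp n} (h : IsFormalAdjoint A B)
    (h' : IsFormalAdjoint A' B') : IsFormalAdjoint (A - A') (B - B') := by
  intro f g
  simp only [LinearMap.sub_apply, Submodule.coe_sub, Pi.sub_apply, sub_mul, mul_sub]
  rw [integral_sub (integrable_smoothFn_mul _ _) (integrable_smoothFn_mul _ _),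
    integral_sub (integrable_smoothFn_mul _ _) (integrable_smoothFn_mul _ _), h, h']

theorem IsFormalAdjoint.comp {n : ℕ} {A B A' B' : SmoothOp n} (h : IsFormalAdjoint A B)
    (h' : IsFormalAdjoint A' B') : IsFormalAdjoint (A ∘ₗ A') (B' ∘ₗ B) :=
  fun f g => (h (A' f) g).trans (h' f (B g))

/-- The pairing is bilinear, so the difference `D = B g - B' g` is tested against its complex
conjugate. This gives `∫ ‖D‖² = 0`, and continuity forces `D = 0` everywhere. -/
theorem IsFormalAdjoint.unique {n : ℕ} {A B B' : SmoothOp n} (h : IsFormalAdjoint A B)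
    (h' : IsFormalAdjoint A B') : B = B' := by
  ext1 g
  set D : SmoothFn n := B g - B' g with hD
  let F : SmoothFn n := ⟨fun x => (starRingEnd ℂ) ((D : Sph n → ℂ) x),
    (Complex.conjCLE.contDiff (n := ∞)).comp_contMDiff D.2⟩
  have h0 : ∫ x, (F : Sph n → ℂ) x * (D : Sph n → ℂ) x
      ∂(volume : Measure (Amb n)).toSphere = 0 := by
    have h1 := (h F g).symm.trans (h' F g)
    rw [← sub_eq_zero, ← integral_sub (integrable_smoothFn_mul _ _)
      (integrable_smoothFn_mul _ _)] at h1
    rw [← h1]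
    refine integral_congr_ae (Eventually.of_forall fun x => ?_)
    simp [hD, mul_sub]
  have h2 : ∀ x, (F : Sph n → ℂ) x * (D : Sph n → ℂ) x = ((‖(D : Sph n → ℂ) x‖ ^ 2 : ℝ) : ℂ) := by
    intro x
    change (starRingEnd ℂ) ((D : Sph n → ℂ) x) * (D : Sph n → ℂ) x = _
    rw [Complex.conj_mul', Complex.ofReal_pow]
  simp only [h2] at h0
  rw [integral_complex_ofReal] at h0
  have hc : Continuous fun x => ‖(D : Sph n → ℂ) x‖ ^ 2 := (continuous_smoothFn D).norm.pow 2
  have h3 := (integral_eq_zero_iff_of_nonneg (fun x => by positivity)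
    (hc.integrable_of_hasCompactSupport (HasCompactSupport.of_compactSpace _))).1
    (by exact_mod_cast h0)
  have h4 := (hc.ae_eq_iff_eq _ continuous_const).1 h3
  rw [← sub_eq_zero, ← hD]
  ext x
  exact norm_eq_zero.1 ((pow_eq_zero_iff two_ne_zero).1 (congrFun h4 x))

/-- Each `poissonOp` is a polynomial in `Δ`. Commutation is needed because taking adjoints reverses
the composition in the recursion. -/
theorem sphLap_comp_poissonOp (n : ℕ) (lam : ℂ) (j : ℕ) :
    sphLap n ∘ₗ poissonOp n lam j = poissonOp n lam j ∘ₗ sphLap n := by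
  induction j using Nat.twoStepInduction with
  | zero => rfl
  | one => simp [poissonOp, LinearMap.comp_sub, LinearMap.sub_comp, LinearMap.comp_smul,
      LinearMap.smul_comp]
  | more j h0 h1 =>
    rw [poissonOp]
    simp only [LinearMap.comp_add, LinearMap.add_comp, LinearMap.comp_sub, LinearMap.sub_comp,
      LinearMap.comp_smul, LinearMap.smul_comp, h0, h1, LinearMap.comp_assoc]
    rw [← LinearMap.comp_assoc, h1, LinearMap.comp_assoc]

theorem isFormalAdjoint_poissonOp (n : ℕ) (lam : ℂ) (j : ℕ) :
    IsFormalAdjoint (poissonOp n lam j) (poissonOp n lam j) := by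
  induction j using Nat.twoStepInduction with
  | zero => exact isFormalAdjoint_id n
  | one => exact (isFormalAdjoint_sphLap n).sub ((isFormalAdjoint_id n).smul _)
  | more j h0 h1 =>
    have h := (isFormalAdjoint_sphLap n).comp h1
    rw [← sphLap_comp_poissonOp] at h
    exact (h.sub (h1.smul _)).add (h0.smul _)

/-- Reversing the sign of each factor `n/2 - lam - j` gives a sign `(-1)^N` that cancels the one in
the value of `P_{2N}`. -/
theorem inv_normFactor_mul (n N : ℕ) (lam : ℂ) :
    (normFactor n N lam)⁻¹ * ((-1) ^ N * poch ((n : ℂ) / 2) N * poch lam N) =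
      poch ((n : ℂ) / 2) N * poch lam N /
        (2 ^ (2 * N) * (N.factorial : ℂ) * poch (lam - (n : ℂ) / 2 + 1) N) := by
  have h : ∏ j ∈ Finset.Icc 1 N, ((n : ℂ) / 2 - lam - j) =
      (-1) ^ N * poch (lam - (n : ℂ) / 2 + 1) N := by
    induction N with
    | zero => simp [poch]
    | succ N ih =>
      rw [Finset.prod_Icc_succ_top (by omega), ih, poch, poch, Finset.prod_range_succ]
      push_cast
      ring
  rw [normFactor, h]
  generalize poch (lam - (n : ℂ) / 2 + 1) N = c
  generalize poch ((n : ℂ) / 2) N = a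
  generalize poch lam N = b
  rw [div_eq_mul_inv]
  have h2 : ((-1 : ℂ) ^ N)⁻¹ = (-1) ^ N := by rw [← inv_pow]; norm_num
  simp only [mul_inv, h2]
  have h1 : ((-1 : ℂ) ^ N) * (-1) ^ N = 1 := by rw [← mul_pow]; simp
  linear_combination a * b * (2 ^ (2 * N))⁻¹ * (N.factorial : ℂ)⁻¹ * c⁻¹ * h1

end

theorem mainTheorem4 (n : ℕ) (hn : 1 ≤ n) (N : ℕ) :
    -- the family `P_{2N}` is well defined
    (∃! P : ℂ → SmoothOp n, IsPFamily n N P) ∧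
    -- values of `P_{2N}(lam)` and of its formal adjoint on the constant function `1`
    (∀ P : ℂ → SmoothOp n, IsPFamily n N P → ∀ lam : ℂ,
      P lam (oneFn n) = ((-1) ^ N * poch ((n : ℂ) / 2) N * poch lam N) • oneFn n ∧
      (∃! B : SmoothOp n, IsFormalAdjoint (P lam) B) ∧
      ∀ B : SmoothOp n, IsFormalAdjoint (P lam) B →
        B (oneFn n) = ((-1) ^ N * poch ((n : ℂ) / 2) N * poch lam N) • oneFn n) ∧
    -- values of `T_{2N}(lam)` on the constant function `1`
    (∀ lam : ℂ, IsRegularParameter n N lam →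
      (∃! A : SmoothOp n, IsSolutionOperator n N lam A) ∧
      ∀ A : SmoothOp n, IsSolutionOperator n N lam A →
        A (oneFn n) =
          (poch ((n : ℂ) / 2) N * poch lam N /
            (2 ^ (2 * N) * (N.factorial : ℂ) * poch (lam - (n : ℂ) / 2 + 1) N)) • oneFn n) := by
  refine ⟨?_, ?_, ?_⟩
  · simp only [isPFamily_iff]
    exact existsUnique_eq
  · intro P hP lam
    rw [isPFamily_iff] at hP
    subst hP
    have hadj := isFormalAdjoint_poissonOp n lam N
    refine ⟨poissonOp_oneFn n lam N, ⟨_, hadj, fun B hB => hB.unique hadj⟩, fun B hB => ?_⟩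
    rw [hB.unique hadj, poissonOp_oneFn]
  · intro lam hlam
    simp only [isSolutionOperator_iff hlam]
    refine ⟨existsUnique_eq, ?_⟩
    rintro A rfl
    rw [LinearMap.smul_apply, poissonOp_oneFn, smul_smul, inv_normFactor_mul]
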